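/- **Conventions.** A coarse space is a set $X$ with a family of *controlled* subsets of $X\times X$ that is closed under finite unions, subsets, transposition and composition, contains the diagonal, and covers $X\times X$. Maps $f,g\colon S\to X$ are *close* if $\{(f(s),g(s)) : s\in S\}$ is controlled; $B\subseteq X$ is *bounded* if $B\hookrightarrow X$ is close to a constant map (the empty set is always bounded). A map is *coarse* if it sends controlled sets to controlled sets and inverse images of bounded sets are bounded. Subsets and products carry the evident coarse structures. For $M \subseteq X\times X$ and $S\subseteq X$ put $M[S]=\{y : (x,y)\in M \text{ for some } x\in S\}$. The *coarse disjoint union* $\bigvee_i X_i$ is the disjoint union of the sets $X_i$, the controlled sets being the subsets of sets $\bigcup_i M_i\cup\bigcup_{i,j}B_i\times B_j$ with $M_i\subseteq X_i\times X_i$ controlled and $B_i\subseteq X_i$ bounded. A *generalised ray* $R$ is $[0,\infty)$ with a coarse structure in which every controlled set lies in an open controlled set, bounded sets have compact closure, and for controlled $M,N$ and $a\ge 0$ the sets $M+N$, $\{(u,v) : x\le u,v\le y \text{ for some } (x,y)\in M\}$ and $a+M=\{(a+x,a+y) : (x,y)\in M\}$ are controlled. An *elementary coarse homotopy* between coarse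 maps $f_0,f_1\colon X\to Y$ is a coarse map $H\colon \{(x,t)\in X\times R : t\le p(x)+1\}\to Y$, for some generalised ray $R$ and coarse map $p\colon X\to R$, with $f_0(x)=H(x,0)$ and $f_1(x)=H(x,p(x)+1)$. Coarse maps are *coarsely homotopic* if a chain of elementary coarse homotopies links them; *coarse homotopy equivalences* are defined accordingly. $X$ is *flasque* if there is a map $t\colon X\to X$, close to the identity, such that for each bounded $B$ one has $t^n[X]\cap B=\emptyset$ for all large $n$, and $\bigcup_{n}(t^n\times t^n)[M]$ is controlled for each controlled $M$. A decomposition $X=A\cup B$ is *coarsely excisive* if for each controlled $m$ there is a controlled $M$ with $m[A]\cap m[B]\subseteq M[A\cap B]$. Spectra are sequences of pointed spaces $E_n$ with pointed maps $E_n\to\Omega E_{n+1}$; a weak equivalence is a map inducing isomorphisms on all stable homotopy groups $\pi_k$, $k\in\mathbb Z$; a spectrum is weakly contractible if all its $\pi_k$ vanish; coproducts are levelwise wedges; a commutative square $B\leftarrow A\to C$, $B\to D\leftarrow C$ is a homotopy pushout if the map from the levelwise reduced double mapping cylinder of $B\leftarrow A\to C$ to $D$ is a weak equivalence. A functor $E$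 from coarse spaces and coarse maps to spectra is *coarsely excisive* if (1) $E(X)$ is weakly contractible for flasque $X$; (2) $E$ takes coarse homotopy equivalences to weak equivalences; (3) for each coarsely excisive decomposition $X=A\cup B$ the square of $E(A\cap B)$, $E(A)$, $E(B)$, $E(X)$ is a homotopy pushout; (4) for each family $(X_i)$ of coarse spaces the canonical map $\bigvee_i E(X_i)\to E(\bigvee_i X_i)$ is a weak equivalence. For a compact Hausdorff space $X$ let $\overline{\mathcal O}X=(X\times[0,1])/(X\times\{0\})$ (one point, the apex, if $X=\emptyset$), and let $\mathcal OX\subseteq\overline{\mathcal O}X$ be the *open cone*, the complement of $X\times\{1\}$, with the *continuously controlled* coarse structure: $M\subseteq\mathcal OX\times\mathcal OX$ is controlled if every $(a,b)$ in the closure of $M$ in $\overline{\mathcal O}X\times\overline{\mathcal O}X$ for which $a$ or $b$ lies in $X\times\{1\}$ satisfies $a=b$. A continuous $f\colon X\to Y$ induces the coarse map $[x,t]\mapsto[f(x),t]$. For $U\subseteq X$ let $\mathcal OU\subseteq\mathcal OX$ be the coarse subspace consisting of the apex and all points $[x,t]$ with $x\in U$. **Theorem.** Let $E$ be a coarsely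 excisive functor. Then $X\mapsto E(\mathcal OX)$ is an excisive functor on the category of compact Hausdorff spaces that are homotopy equivalent to CW-complexes. That is, it is a functor on this category, and 1. if a continuous map $f\colon X\to Y$ in this category is a homotopy equivalence, then $E(\mathcal OX)\to E(\mathcal OY)$ is a weak equivalence; 2. if $X$ is in this category and $X=U\cup V$ with $U,V\subseteq X$ open, then the square $$\begin{array}{ccc} E(\mathcal O(U\cap V)) & \to & E(\mathcal OU)\\ \downarrow & & \downarrow\\ E(\mathcal OV) & \to & E(\mathcal OX)\end{array}$$ is a homotopy pushout; 3. if $X=\coprod_{i} X_i$ is a disjoint union of topological spaces with $X$ and all $X_i$ in this category, then the canonical map $\bigvee_i E(\mathcal OX_i)\to E(\mathcal OX)$ is a weak equivalence. -/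

import Mathlib

open CategoryTheory Set Topology unitInterval
open scoped NNReal

universe u v w

/-! ### Spectra -/

/-- A (sequential) spectrum: pointed topological spaces `X₀, X₁, …` with pointed continuous maps
`Xₙ → Ω Xₙ₊₁`, the adjoints of the structure maps `Σ Xₙ → Xₙ₊₁`. -/
structure TopSpectrum : Type (v + 1) where
  space : ℕ → Type v
  [top : ∀ n, TopologicalSpace (space n)]
  pt : ∀ n, space n
  adj : ∀ n, C(space n, C(I, space (n + 1)))
  adj_zero : ∀ n x, adj n x 0 = pt (n + 1)
  adj_one : ∀ n x, adj n x 1 = pt (n + 1)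
  adj_pt : ∀ n s, adj n (pt n) s = pt (n + 1)

attribute [instance] TopSpectrum.top

namespace TopSpectrum

/-- A map of spectra: pointed continuous maps that commute strictly with the structure maps. -/
@[ext]
structure Hom (A : TopSpectrum.{v}) (B : TopSpectrum.{w}) where
  app : ∀ n, C(A.space n, B.space n)
  app_pt : ∀ n, app n (A.pt n) = B.pt n
  app_adj : ∀ n x s, app (n + 1) (A.adj n x s) = B.adj n (app n x) s

instance : Category TopSpectrum.{v} where
  Hom A B := Hom A B
  id A := ⟨fun _ => ContinuousMap.id _, fun _ => rfl, fun _ _ _ => rfl⟩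
  comp f g := ⟨fun n => (g.app n).comp (f.app n),
    fun n => by simp [f.app_pt, g.app_pt], fun n x s => by simp [f.app_adj, g.app_adj]⟩

/-- The stabilization `π_m (Xₙ) → π_{m+1} (Xₙ₊₁)` on representatives. -/
def stab (A : TopSpectrum.{v}) {n m : ℕ} (γ : GenLoop (Fin m) (A.space n) (A.pt n)) :
    GenLoop (Fin (m + 1)) (A.space (n + 1)) (A.pt (n + 1)) :=
  ⟨⟨fun y => A.adj n (γ.1 (Fin.tail y)) (y 0), by
      have h : Continuous fun y : Fin (m + 1) → I => (Fin.tail y : Fin m → I) :=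
        continuous_pi fun i => continuous_apply _
      fun_prop⟩, by
    rintro y ⟨i, hi⟩
    refine Fin.cases (fun hi => ?_) (fun j hj => ?_) i hi
    · rcases hi with hi | hi
      · simp [hi, A.adj_zero]
      · simp [hi, A.adj_one]
    · have h : γ.1 (Fin.tail y) = A.pt n := γ.2 (Fin.tail y) ⟨j, hj⟩
      change A.adj n (γ.1 (Fin.tail y)) (y 0) = _
      rw [h, A.adj_pt]⟩

/-- Representatives of elements of the stable homotopy group `π_k`, `k ∈ ℤ`: based maps
`(I^m, ∂I^m) → (Xₙ, *)` with `m = n + k`. -/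
structure StableRep (A : TopSpectrum.{v}) (k : ℤ) where
  n : ℕ
  m : ℕ
  index : (m : ℤ) = n + k
  loop : GenLoop (Fin m) (A.space n) (A.pt n)

/-- The relation that generates the colimit `π_k A = colimₙ π_{n+k} (Xₙ)`. -/
inductive StableRel (A : TopSpectrum.{v}) (k : ℤ) : StableRep A k → StableRep A k → Prop
  | homotopy (n m : ℕ) (h : (m : ℤ) = n + k) (γ γ' : GenLoop (Fin m) (A.space n) (A.pt n)) :
      GenLoop.Homotopic γ γ' → StableRel A k ⟨n, m, h, γ⟩ ⟨n, m, h, γ'⟩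
  | stab (n m : ℕ) (h : (m : ℤ) = n + k) (γ : GenLoop (Fin m) (A.space n) (A.pt n)) :
      StableRel A k ⟨n, m, h, γ⟩ ⟨n + 1, m + 1, by push_cast; omega, A.stab γ⟩

/-- The underlying set of the stable homotopy group `π_k A`. -/
def StablePi (A : TopSpectrum.{v}) (k : ℤ) : Type v := Quot (StableRel A k)

/-- The map of representatives induced by a map of spectra. -/
def Hom.mapRep {A : TopSpectrum.{v}} {B : TopSpectrum.{w}} (f : Hom A B) (k : ℤ)
    (r : StableRep A k) : StableRep B k :=
  ⟨r.n, r.m, r.index, ⟨(f.app r.n).comp r.loop.1, fun y hy => by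
    have h : r.loop.1 y = A.pt r.n := r.loop.2 y hy
    simp [h, f.app_pt]⟩⟩

/-- The map `π_k A → π_k B` induced by a map of spectra. -/
def Hom.mapPi {A : TopSpectrum.{v}} {B : TopSpectrum.{w}} (f : Hom A B) (k : ℤ) :
    StablePi A k → StablePi B k :=
  Quot.map (f.mapRep k) (by
    rintro _ _ (⟨n, m, h, γ, γ', H⟩ | ⟨n, m, h, γ⟩)
    · exact StableRel.homotopy n m h _ _ (H.map fun F => F.compContinuousMap (f.app n))
    · have e : f.mapRep k ⟨n + 1, m + 1, by push_cast; omega, A.stab γ⟩ =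
          ⟨n + 1, m + 1, by push_cast; omega, B.stab (f.mapRep k ⟨n, m, h, γ⟩).loop⟩ := by
        unfold Hom.mapRep
        congr 1
        apply Subtype.ext
        ext y
        exact f.app_adj n _ _
      rw [e]
      exact StableRel.stab n m h _)

/-- A weak homotopy equivalence of spectra: an isomorphism on all stable homotopy groups. -/
def Hom.IsWeakEquiv {A : TopSpectrum.{v}} {B : TopSpectrum.{w}} (f : Hom A B) : Prop :=
  ∀ k : ℤ, Function.Bijective (f.mapPi k)

/-- A spectrum is weakly contractible if all its stable homotopy groups vanish. -/
def WeaklyContractible (A : TopSpectrum.{v}) : Prop := ∀ k : ℤ, Subsingleton (StablePi A k)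

section Wedge

variable {ι : Type u} (A : ι → TopSpectrum.{v})

/-- The relation that identifies all base points with one extra point. -/
inductive WedgeRel (n : ℕ) :
    PUnit.{u + 1} ⊕ (Σ i, (A i).space n) → PUnit.{u + 1} ⊕ (Σ i, (A i).space n) → Prop
  | base (i : ι) : WedgeRel n (Sum.inr ⟨i, (A i).pt n⟩) (Sum.inl PUnit.unit)

/-- The inclusion of a summand in the wedge of the `n`-th spaces. -/
def wedgeIn (n : ℕ) (i : ι) : C((A i).space n, Quot (WedgeRel A n)) :=
  ⟨fun x => Quot.mk _ (Sum.inr ⟨i, x⟩),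
    continuous_quot_mk.comp (continuous_inr.comp continuous_sigmaMk)⟩

/-- The coproduct in the category of spectra: the levelwise wedge of pointed spaces. -/
def wedge : TopSpectrum.{max u v} where
  space n := Quot (WedgeRel A n)
  pt n := Quot.mk _ (Sum.inl PUnit.unit)
  adj n :=
    { toFun := Quot.lift
        (Sum.elim (fun _ => ContinuousMap.const I (Quot.mk _ (Sum.inl PUnit.unit)))
          (fun p => (wedgeIn A (n + 1) p.1).comp ((A p.1).adj n p.2))) (by
            rintro _ _ ⟨i⟩
            ext s
            simp only [Sum.elim_inr, Sum.elim_inl, ContinuousMap.comp_apply, (A i).adj_pt,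
              ContinuousMap.const_apply]
            exact Quot.sound (WedgeRel.base i))
      continuous_toFun := continuous_quot_lift _ (by
        refine continuous_sum_dom.2 ⟨continuous_const, continuous_sigma fun i => ?_⟩
        exact (ContinuousMap.continuous_postcomp (wedgeIn A (n + 1) i)).comp
          ((A i).adj n).continuous) }
  adj_zero n x := by
    induction x using Quot.ind with | mk a => ?_
    rcases a with _ | ⟨i, x⟩
    · rfl
    · change wedgeIn A (n + 1) i ((A i).adj n x 0) = _
      rw [(A i).adj_zero]
      exact Quot.sound (WedgeRel.base i)
  adj_one n x := by
    induction x using Quot.ind with | mk a => ?_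
    rcases a with _ | ⟨i, x⟩
    · rfl
    · change wedgeIn A (n + 1) i ((A i).adj n x 1) = _
      rw [(A i).adj_one]
      exact Quot.sound (WedgeRel.base i)
  adj_pt n s := rfl

/-- The map out of the wedge with given components. -/
def wedgeDesc {A : ι → TopSpectrum.{v}} {B : TopSpectrum.{w}} (f : ∀ i, Hom (A i) B) :
    Hom (wedge A) B where
  app n :=
    { toFun := Quot.lift (Sum.elim (fun _ => B.pt n) (fun p => (f p.1).app n p.2)) (by
        rintro _ _ ⟨i⟩
        exact (f i).app_pt n)
      continuous_toFun := continuous_quot_lift _ (by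
        refine continuous_sum_dom.2 ⟨continuous_const, continuous_sigma fun i => ?_⟩
        exact ((f i).app n).continuous) }
  app_pt n := rfl
  app_adj n x s := by
    induction x using Quot.ind with | mk a => ?_
    rcases a with _ | ⟨i, x⟩
    · exact (B.adj_pt n s).symm
    · exact (f i).app_adj n x s

end Wedge

section HomotopyPushout

variable {A B C D : TopSpectrum.{v}}

/-- The identifications in the reduced double mapping cylinder of `Bₙ ← Aₙ → Cₙ`. -/
inductive CylRel (f : A ⟶ B) (g : A ⟶ C) (n : ℕ) :
    (B.space n ⊕ C.space n) ⊕ (A.space n × I) →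
    (B.space n ⊕ C.space n) ⊕ (A.space n × I) → Prop
  | left (a : A.space n) : CylRel f g n (Sum.inr (a, 0)) (Sum.inl (Sum.inl (f.app n a)))
  | right (a : A.space n) : CylRel f g n (Sum.inr (a, 1)) (Sum.inl (Sum.inr (g.app n a)))
  | base (t : I) : CylRel f g n (Sum.inr (A.pt n, t)) (Sum.inl (Sum.inl (B.pt n)))

/-- The adjoint structure map of the double mapping cylinder before passing to the quotient. -/
def cylAdj (f : A ⟶ B) (g : A ⟶ C) (n : ℕ) :
    C((B.space n ⊕ C.space n) ⊕ (A.space n × I), C(I, Quot (CylRel f g (n + 1)))) where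
  toFun := Sum.elim
    (Sum.elim
      (fun b => (⟨fun x => Quot.mk _ (Sum.inl (Sum.inl x)), by fun_prop⟩ :
        C(B.space (n + 1), Quot (CylRel f g (n + 1)))).comp (B.adj n b))
      (fun c => (⟨fun x => Quot.mk _ (Sum.inl (Sum.inr x)), by fun_prop⟩ :
        C(C.space (n + 1), Quot (CylRel f g (n + 1)))).comp (C.adj n c)))
    (fun p => (⟨fun q : (A.space n × I) × I => Quot.mk _ (Sum.inr (A.adj n q.1.1 q.2, q.1.2)),
        by fun_prop⟩ : C((A.space n × I) × I, Quot (CylRel f g (n + 1)))).curry p)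
  continuous_toFun := by
    refine continuous_sum_dom.2 ⟨continuous_sum_dom.2 ⟨?_, ?_⟩, ContinuousMap.continuous _⟩
    · exact (ContinuousMap.continuous_postcomp _).comp (B.adj n).continuous
    · exact (ContinuousMap.continuous_postcomp _).comp (C.adj n).continuous

theorem cyl_base (f : A ⟶ B) (g : A ⟶ C) (n : ℕ) :
    Quot.mk (CylRel f g n) (Sum.inl (Sum.inr (C.pt n))) =
      Quot.mk (CylRel f g n) (Sum.inl (Sum.inl (B.pt n))) := by
  rw [← g.app_pt n, ← Quot.sound (CylRel.right (f := f) (g := g) (A.pt n))]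
  exact Quot.sound (CylRel.base 1)

/-- The homotopy pushout of `B ← A → C`: the levelwise reduced double mapping cylinder. -/
def cyl (f : A ⟶ B) (g : A ⟶ C) : TopSpectrum.{v} where
  space n := Quot (CylRel f g n)
  pt n := Quot.mk _ (Sum.inl (Sum.inl (B.pt n)))
  adj n :=
    { toFun := Quot.lift (cylAdj f g n) (by
        rintro _ _ (a | a | t)
        · ext s
          refine (Quot.sound (CylRel.left (f := f) (g := g) (A.adj n a s))).trans ?_
          rw [f.app_adj n a s]; rfl
        · ext s
          refine (Quot.sound (CylRel.right (f := f) (g := g) (A.adj n a s))).trans ?_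
          rw [g.app_adj n a s]; rfl
        · ext s
          change Quot.mk (CylRel f g (n + 1)) (Sum.inr (A.adj n (A.pt n) s, t)) =
            Quot.mk (CylRel f g (n + 1)) (Sum.inl (Sum.inl (B.adj n (B.pt n) s)))
          rw [A.adj_pt, B.adj_pt]
          exact Quot.sound (CylRel.base t))
      continuous_toFun := continuous_quot_lift _ (cylAdj f g n).continuous }
  adj_zero n x := by
    induction x using Quot.ind with | mk p => ?_
    rcases p with (b | c) | ⟨a, t⟩
    · change Quot.mk (CylRel f g (n + 1)) (Sum.inl (Sum.inl (B.adj n b 0))) = _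
      rw [B.adj_zero]
    · change Quot.mk (CylRel f g (n + 1)) (Sum.inl (Sum.inr (C.adj n c 0))) = _
      rw [C.adj_zero]; exact cyl_base f g _
    · change Quot.mk (CylRel f g (n + 1)) (Sum.inr (A.adj n a 0, t)) = _
      rw [A.adj_zero]; exact Quot.sound (CylRel.base t)
  adj_one n x := by
    induction x using Quot.ind with | mk p => ?_
    rcases p with (b | c) | ⟨a, t⟩
    · change Quot.mk (CylRel f g (n + 1)) (Sum.inl (Sum.inl (B.adj n b 1))) = _
      rw [B.adj_one]
    · change Quot.mk (CylRel f g (n + 1)) (Sum.inl (Sum.inr (C.adj n c 1))) = _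
      rw [C.adj_one]; exact cyl_base f g _
    · change Quot.mk (CylRel f g (n + 1)) (Sum.inr (A.adj n a 1, t)) = _
      rw [A.adj_one]; exact Quot.sound (CylRel.base t)
  adj_pt n s := by
    change Quot.mk (CylRel f g (n + 1)) (Sum.inl (Sum.inl (B.adj n (B.pt n) s))) = _
    rw [B.adj_pt]

/-- The canonical map from the double mapping cylinder of `B ← A → C` to the fourth corner of a
commutative square. -/
def cylDesc (f : A ⟶ B) (g : A ⟶ C) (h : B ⟶ D) (k : C ⟶ D) (e : f ≫ h = g ≫ k) :
    cyl f g ⟶ D where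
  app n :=
    { toFun := Quot.lift
        (Sum.elim (Sum.elim (h.app n) (k.app n)) (fun p => h.app n (f.app n p.1))) (by
          rintro _ _ (a | a | t)
          · rfl
          · exact congrArg (fun φ : A ⟶ D => φ.app n a) e
          · exact congrArg (h.app n) (f.app_pt n))
      continuous_toFun := continuous_quot_lift _ (by
        refine continuous_sum_dom.2 ⟨continuous_sum_dom.2 ⟨?_, ?_⟩, ?_⟩
        · exact (h.app n).continuous
        · exact (k.app n).continuous
        · exact (h.app n).continuous.comp ((f.app n).continuous.comp continuous_fst)) }
  app_pt n := h.app_pt n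
  app_adj n x s := by
    induction x using Quot.ind with | mk p => ?_
    rcases p with (b | c) | ⟨a, t⟩
    · exact h.app_adj n b s
    · exact k.app_adj n c s
    · exact (congrArg (h.app (n + 1)) (f.app_adj n a s)).trans (h.app_adj n _ s)

/-- A commutative square of spectra is a homotopy push-out diagram if the map from the double
mapping cylinder to the fourth corner is a weak homotopy equivalence. -/
def IsHomotopyPushout (f : A ⟶ B) (g : A ⟶ C) (h : B ⟶ D) (k : C ⟶ D) : Prop :=
  ∃ e : f ≫ h = g ≫ k, Hom.IsWeakEquiv (cylDesc f g h k e)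

end HomotopyPushout

end TopSpectrum

/-! ### Coarse spaces -/

/-- The composite `M₁ M₂` of two relations. -/
def relComp {X : Type u} (M N : Set (X × X)) : Set (X × X) :=
  {p | ∃ y, (p.1, y) ∈ M ∧ (y, p.2) ∈ N}

/-- The set `M[S]`. -/
def relImage {X : Type u} (M : Set (X × X)) (S : Set X) : Set X := {y | ∃ x ∈ S, (x, y) ∈ M}

/-- A (unital) coarse structure on a set. -/
structure CoarseStructure (X : Type u) where
  Controlled : Set (X × X) → Prop
  union : ∀ {M N}, Controlled M → Controlled N → Controlled (M ∪ N)
  subset : ∀ {M N}, Controlled N → M ⊆ N → Controlled M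
  symm : ∀ {M}, Controlled M → Controlled (Prod.swap ⁻¹' M)
  comp : ∀ {M N}, Controlled M → Controlled N → Controlled (relComp M N)
  diag : Controlled {p | p.1 = p.2}
  connected : ∀ x y, ∃ M, Controlled M ∧ (x, y) ∈ M

namespace CoarseStructure

/-- Bounded subsets: those whose inclusion is close to a constant map. (The empty subset is
bounded also in the empty space, where there are no points to be the constant value.) -/
def Bounded {X : Type u} (s : CoarseStructure X) (B : Set X) : Prop :=
  B = ∅ ∨ ∃ x, s.Controlled (B ×ˢ {x})

theorem Bounded.mono {X : Type u} {s : CoarseStructure X} {B B' : Set X} (h : s.Bounded B)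
    (hB : B' ⊆ B) : s.Bounded B' := by
  rcases h with rfl | ⟨x, hx⟩
  · exact Or.inl (subset_empty_iff.1 hB)
  · exact Or.inr ⟨x, s.subset hx (prod_mono hB le_rfl)⟩

theorem Bounded.prod {X : Type u} {s : CoarseStructure X} {B B' : Set X} (h : s.Bounded B)
    (h' : s.Bounded B') : s.Controlled (B ×ˢ B') := by
  rcases h with rfl | ⟨x, hx⟩
  · exact s.subset s.diag (by simp)
  rcases h' with rfl | ⟨y, hy⟩
  · exact s.subset s.diag (by simp)
  obtain ⟨M, hM, hxy⟩ := s.connected x y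
  refine s.subset (s.comp (s.comp hx hM) (s.symm hy)) ?_
  rintro ⟨b, b'⟩ ⟨hb, hb'⟩
  exact ⟨y, ⟨x, ⟨hb, rfl⟩, hxy⟩, ⟨hb', rfl⟩⟩

theorem bounded_of_prod {X : Type u} {s : CoarseStructure X} {B : Set X}
    (h : s.Controlled (B ×ˢ B)) : s.Bounded B := by
  rcases B.eq_empty_or_nonempty with rfl | ⟨b, hb⟩
  · exact Or.inl rfl
  · exact Or.inr ⟨b, s.subset h (prod_mono le_rfl (by simpa using hb))⟩

/-- Two maps into a coarse space are close. -/
def Close {S : Type w} {X : Type u} (s : CoarseStructure X) (f g : S → X) : Prop :=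
  s.Controlled (range fun a => (f a, g a))

/-- A coarse structure is compatible with a topology on the same (Hausdorff) space. -/
def CompatibleWithTopology {X : Type u} [TopologicalSpace X] (s : CoarseStructure X) : Prop :=
  (∀ M, s.Controlled M → ∃ W, s.Controlled W ∧ IsOpen W ∧ M ⊆ W) ∧
    ∀ B, s.Bounded B → IsCompact (closure B)

/-- The product coarse structure. -/
def prod {X : Type u} {Y : Type v} (s : CoarseStructure X) (t : CoarseStructure Y) :
    CoarseStructure (X × Y) where
  Controlled M := ∃ M₁ M₂, s.Controlled M₁ ∧ t.Controlled M₂ ∧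
    ∀ p ∈ M, (p.1.1, p.2.1) ∈ M₁ ∧ (p.1.2, p.2.2) ∈ M₂
  union := by
    rintro M N ⟨M₁, M₂, h₁, h₂, h⟩ ⟨N₁, N₂, k₁, k₂, k⟩
    refine ⟨M₁ ∪ N₁, M₂ ∪ N₂, s.union h₁ k₁, t.union h₂ k₂, ?_⟩
    rintro p (hp | hp)
    · exact ⟨Or.inl (h p hp).1, Or.inl (h p hp).2⟩
    · exact ⟨Or.inr (k p hp).1, Or.inr (k p hp).2⟩
  subset := by
    rintro M N ⟨N₁, N₂, k₁, k₂, k⟩ hMN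
    exact ⟨N₁, N₂, k₁, k₂, fun p hp => k p (hMN hp)⟩
  symm := by
    rintro M ⟨M₁, M₂, h₁, h₂, h⟩
    exact ⟨_, _, s.symm h₁, t.symm h₂, fun p hp => h _ hp⟩
  comp := by
    rintro M N ⟨M₁, M₂, h₁, h₂, h⟩ ⟨N₁, N₂, k₁, k₂, k⟩
    refine ⟨_, _, s.comp h₁ k₁, t.comp h₂ k₂, ?_⟩
    rintro p ⟨y, hy, hy'⟩
    exact ⟨⟨y.1, (h _ hy).1, (k _ hy').1⟩, ⟨y.2, (h _ hy).2, (k _ hy').2⟩⟩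
  diag := ⟨_, _, s.diag, t.diag, fun p hp => ⟨congrArg Prod.fst hp, congrArg Prod.snd hp⟩⟩
  connected := by
    intro x y
    obtain ⟨M, hM, h⟩ := s.connected x.1 y.1
    obtain ⟨N, hN, k⟩ := t.connected x.2 y.2
    refine ⟨{(x, y)}, ⟨M, N, hM, hN, ?_⟩, rfl⟩
    rintro p rfl
    exact ⟨h, k⟩

/-- The subspace coarse structure. -/
def sub {X : Type u} (s : CoarseStructure X) (A : Set X) : CoarseStructure A where
  Controlled M := s.Controlled (Prod.map Subtype.val Subtype.val '' M)
  union h k := by rw [image_union]; exact s.union h k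
  subset h k := s.subset h (image_mono k)
  symm {M} h := by
    refine s.subset (s.symm h) ?_
    rintro _ ⟨p, hp, rfl⟩
    exact ⟨p.swap, hp, rfl⟩
  comp {M N} h k := by
    refine s.subset (s.comp h k) ?_
    rintro _ ⟨p, ⟨y, hy, hy'⟩, rfl⟩
    exact ⟨y, ⟨_, hy, rfl⟩, ⟨_, hy', rfl⟩⟩
  diag := by
    refine s.subset s.diag ?_
    rintro _ ⟨p, hp, rfl⟩
    exact congrArg Subtype.val hp
  connected x y := by
    obtain ⟨M, hM, h⟩ := s.connected x y
    refine ⟨{(x, y)}, s.subset hM ?_, rfl⟩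
    rintro _ ⟨_, rfl, rfl⟩
    exact h

/-- The coarse disjoint union `⋁ X_i`. -/
def disjUnion {ι : Type u} {X : ι → Type v} (s : ∀ i, CoarseStructure (X i)) :
    CoarseStructure (Σ i, X i) where
  Controlled M := ∃ (N : ∀ i, Set (X i × X i)) (B : ∀ i, Set (X i)),
    (∀ i, (s i).Controlled (N i)) ∧ (∀ i, (s i).Bounded (B i)) ∧
      M ⊆ (⋃ i, Prod.map (Sigma.mk i) (Sigma.mk i) '' N i) ∪
        ⋃ i, ⋃ j, (Sigma.mk i '' B i) ×ˢ (Sigma.mk j '' B j)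
  union := by
    rintro M M' ⟨N, B, hN, hB, h⟩ ⟨N', B', hN', hB', h'⟩
    refine ⟨fun i => N i ∪ N' i ∪ (B i ×ˢ B i ∪ B' i ×ˢ B' i), fun i => B i ∪ B' i,
      fun i => (s i).union ((s i).union (hN i) (hN' i))
        ((s i).union ((hB i).prod (hB i)) ((hB' i).prod (hB' i))), fun i => ?_, ?_⟩
    · apply bounded_of_prod
      refine (s i).subset ((s i).union
        ((s i).union ((hB i).prod (hB i)) ((hB i).prod (hB' i)))
        ((s i).union ((hB' i).prod (hB i)) ((hB' i).prod (hB' i)))) ?_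
      rintro ⟨x, y⟩ ⟨hx | hx, hy | hy⟩
      · exact Or.inl (Or.inl ⟨hx, hy⟩)
      · exact Or.inl (Or.inr ⟨hx, hy⟩)
      · exact Or.inr (Or.inl ⟨hx, hy⟩)
      · exact Or.inr (Or.inr ⟨hx, hy⟩)
    · rintro p (hp | hp)
      · rcases h hp with hp | hp
        · obtain ⟨i, q, hq, rfl⟩ := mem_iUnion.1 hp
          exact Or.inl (mem_iUnion.2 ⟨i, q, Or.inl (Or.inl hq), rfl⟩)
        · obtain ⟨i, hp⟩ := mem_iUnion.1 hp
          obtain ⟨j, ⟨a, ha, ha'⟩, ⟨b, hb, hb'⟩⟩ := mem_iUnion.1 hp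
          exact Or.inr (mem_iUnion.2 ⟨i, mem_iUnion.2
            ⟨j, ⟨a, Or.inl ha, ha'⟩, ⟨b, Or.inl hb, hb'⟩⟩⟩)
      · rcases h' hp with hp | hp
        · obtain ⟨i, q, hq, rfl⟩ := mem_iUnion.1 hp
          exact Or.inl (mem_iUnion.2 ⟨i, q, Or.inl (Or.inr hq), rfl⟩)
        · obtain ⟨i, hp⟩ := mem_iUnion.1 hp
          obtain ⟨j, ⟨a, ha, ha'⟩, ⟨b, hb, hb'⟩⟩ := mem_iUnion.1 hp
          exact Or.inr (mem_iUnion.2 ⟨i, mem_iUnion.2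
            ⟨j, ⟨a, Or.inr ha, ha'⟩, ⟨b, Or.inr hb, hb'⟩⟩⟩)
  subset := by
    rintro M M' ⟨N, B, hN, hB, h⟩ hM
    exact ⟨N, B, hN, hB, hM.trans h⟩
  symm := by
    rintro M ⟨N, B, hN, hB, h⟩
    refine ⟨fun i => Prod.swap ⁻¹' N i, B, fun i => (s i).symm (hN i), hB, ?_⟩
    rintro p hp
    rcases h hp with hp | hp
    · obtain ⟨i, q, hq, hqp⟩ := mem_iUnion.1 hp
      refine Or.inl (mem_iUnion.2 ⟨i, q.swap, hq, ?_⟩)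
      exact congrArg Prod.swap hqp
    · obtain ⟨i, hp⟩ := mem_iUnion.1 hp
      obtain ⟨j, ha, hb⟩ := mem_iUnion.1 hp
      exact Or.inr (mem_iUnion.2 ⟨j, mem_iUnion.2 ⟨i, hb, ha⟩⟩)
  comp := by
    rintro M M' ⟨N, B, hN, hB, h⟩ ⟨N', B', hN', hB', h'⟩
    have enl : ∀ i, ∀ P : Set (X i × X i), (s i).Controlled P → ∀ S, (s i).Bounded S →
        (s i).Bounded (relImage P S) := by
      rintro i P hP S (rfl | ⟨x, hx⟩)
      · left; ext; simp [relImage]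
      · refine Or.inr ⟨x, (s i).subset ((s i).comp ((s i).symm hP) hx) ?_⟩
        rintro ⟨y, z⟩ ⟨⟨a, ha, hay⟩, hz⟩
        exact ⟨a, hay, ha, hz⟩
    let T : ∀ i, Set (X i) := fun i =>
      (B i ∪ B' i) ∪ (relImage (Prod.swap ⁻¹' N i) (B' i) ∪ relImage (N' i) (B i))
    have uni : ∀ i, ∀ S S' : Set (X i), (s i).Bounded S → (s i).Bounded S' →
        (s i).Bounded (S ∪ S') := by
      intro i S S' hS hS'
      apply bounded_of_prod
      refine (s i).subset ((s i).union
        ((s i).union (hS.prod hS) (hS.prod hS'))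
        ((s i).union (hS'.prod hS) (hS'.prod hS'))) ?_
      rintro ⟨x, y⟩ ⟨hx | hx, hy | hy⟩
      · exact Or.inl (Or.inl ⟨hx, hy⟩)
      · exact Or.inl (Or.inr ⟨hx, hy⟩)
      · exact Or.inr (Or.inl ⟨hx, hy⟩)
      · exact Or.inr (Or.inr ⟨hx, hy⟩)
    refine ⟨fun i => relComp (N i) (N' i), T, fun i => (s i).comp (hN i) (hN' i), fun i =>
      uni i _ _ (uni i _ _ (hB i) (hB' i))
        (uni i _ _ (enl i _ ((s i).symm (hN i)) _ (hB' i)) (enl i _ (hN' i) _ (hB i))), ?_⟩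
    rintro ⟨x, z⟩ ⟨y, hxy, hyz⟩
    rcases h hxy with h1 | h1 <;> rcases h' hyz with h2 | h2
    · obtain ⟨i, ⟨a, b⟩, hq, e⟩ := mem_iUnion.1 h1
      obtain ⟨j, ⟨c, d⟩, hr, e'⟩ := mem_iUnion.1 h2
      simp only [Prod.map_apply, Prod.mk.injEq] at e e'
      obtain ⟨rfl, rfl⟩ := e
      obtain ⟨e1, rfl⟩ := e'
      obtain ⟨rfl, e1⟩ := Sigma.mk.inj_iff.1 e1
      obtain rfl := eq_of_heq e1
      exact Or.inl (mem_iUnion.2 ⟨_, (a, d), ⟨_, hq, hr⟩, rfl⟩)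
    · obtain ⟨i, ⟨a, b⟩, hq, e⟩ := mem_iUnion.1 h1
      obtain ⟨j, h2⟩ := mem_iUnion.1 h2
      obtain ⟨k, ⟨c, hc, e1⟩, ⟨d, hd, e2⟩⟩ := mem_iUnion.1 h2
      simp only [Prod.map_apply, Prod.mk.injEq] at e e1 e2
      obtain ⟨rfl, rfl⟩ := e
      obtain ⟨rfl, e1⟩ := Sigma.mk.inj_iff.1 e1
      obtain rfl := eq_of_heq e1
      exact Or.inr (mem_iUnion.2 ⟨_, mem_iUnion.2 ⟨k,
        ⟨a, Or.inr (Or.inl ⟨_, hc, hq⟩), rfl⟩, ⟨d, Or.inl (Or.inr hd), e2⟩⟩⟩)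
    · obtain ⟨i, h1⟩ := mem_iUnion.1 h1
      obtain ⟨j, ⟨a, ha, e1⟩, ⟨b, hb, e2⟩⟩ := mem_iUnion.1 h1
      obtain ⟨k, ⟨c, d⟩, hr, e'⟩ := mem_iUnion.1 h2
      simp only [Prod.map_apply, Prod.mk.injEq] at e' e1 e2
      obtain ⟨e3, rfl⟩ := e'
      rw [← e2] at e3
      obtain ⟨rfl, e3⟩ := Sigma.mk.inj_iff.1 e3
      obtain rfl := eq_of_heq e3
      exact Or.inr (mem_iUnion.2 ⟨i, mem_iUnion.2 ⟨_,
        ⟨a, Or.inl (Or.inl ha), e1⟩, ⟨d, Or.inr (Or.inr ⟨_, hb, hr⟩), rfl⟩⟩⟩)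
    · obtain ⟨i, h1⟩ := mem_iUnion.1 h1
      obtain ⟨j, ⟨a, ha, e1⟩, -⟩ := mem_iUnion.1 h1
      obtain ⟨k, h2⟩ := mem_iUnion.1 h2
      obtain ⟨l, -, ⟨d, hd, e2⟩⟩ := mem_iUnion.1 h2
      exact Or.inr (mem_iUnion.2 ⟨i, mem_iUnion.2 ⟨l,
        ⟨a, Or.inl (Or.inl ha), e1⟩, ⟨d, Or.inl (Or.inr hd), e2⟩⟩⟩)
  diag := by
    refine ⟨fun i => {p | p.1 = p.2}, fun i => ∅, fun i => (s i).diag, fun i => Or.inl rfl, ?_⟩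
    rintro ⟨⟨i, x⟩, y⟩ h
    obtain rfl : (⟨i, x⟩ : Σ i, X i) = y := h
    exact Or.inl (mem_iUnion.2 ⟨i, (x, x), rfl, rfl⟩)
  connected := by
    classical
    rintro x y
    refine ⟨{(x, y)}, ⟨fun i => {p | p.1 = p.2},
      fun i => Sigma.mk i ⁻¹' {x} ∪ Sigma.mk i ⁻¹' {y}, fun i => (s i).diag, fun i => ?_, ?_⟩, rfl⟩
    · have sing : ∀ z : Σ i, X i, (s i).Bounded (Sigma.mk i ⁻¹' {z}) := by
        rintro ⟨j, a⟩
        rcases (Sigma.mk i ⁻¹' {(⟨j, a⟩ : Σ i, X i)}).eq_empty_or_nonempty with h | ⟨b, hb⟩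
        · exact Or.inl h
        · refine Or.inr ⟨b, (s i).subset (s i).diag ?_⟩
          rintro ⟨c, d⟩ ⟨hc, hd⟩
          have h1 : (⟨i, c⟩ : Σ i, X i) = ⟨i, b⟩ := hc.trans hb.symm
          have h2 : d = b := hd
          exact (sigma_mk_injective h1).trans h2.symm
      apply bounded_of_prod
      refine (s i).subset ((s i).union
        ((s i).union ((sing x).prod (sing x)) ((sing x).prod (sing y)))
        ((s i).union ((sing y).prod (sing x)) ((sing y).prod (sing y)))) ?_
      rintro ⟨a, b⟩ ⟨hx | hx, hy | hy⟩
      · exact Or.inl (Or.inl ⟨hx, hy⟩)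
      · exact Or.inl (Or.inr ⟨hx, hy⟩)
      · exact Or.inr (Or.inl ⟨hx, hy⟩)
      · exact Or.inr (Or.inr ⟨hx, hy⟩)
    · rintro _ rfl
      exact Or.inr (mem_iUnion.2 ⟨x.1, mem_iUnion.2 ⟨y.1,
        ⟨x.2, Or.inl rfl, rfl⟩, ⟨y.2, Or.inr rfl, rfl⟩⟩⟩)

end CoarseStructure

/-- A coarse space. -/
structure CoarseSpace : Type (u + 1) where
  carrier : Type u
  str : CoarseStructure carrier

/-- A map between sets with coarse structures is coarse: it is controlled, and inverse images of
bounded sets are bounded. -/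
structure IsCoarseMap {X : Type u} {Y : Type v} (s : CoarseStructure X) (t : CoarseStructure Y)
    (f : X → Y) : Prop where
  controlled : ∀ M, s.Controlled M → t.Controlled (Prod.map f f '' M)
  proper : ∀ B, t.Bounded B → s.Bounded (f ⁻¹' B)

namespace CoarseSpace

/-- A coarse map. -/
@[ext]
structure Hom (X Y : CoarseSpace.{u}) where
  toFun : X.carrier → Y.carrier
  isCoarse : IsCoarseMap X.str Y.str toFun

/-- The coarse category. -/
instance : Category CoarseSpace.{u} where
  Hom X Y := Hom X Y
  id X := ⟨id, ⟨fun M h => by simpa using h, fun B h => h⟩⟩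
  comp f g := ⟨g.toFun ∘ f.toFun, ⟨fun M h => by
    have := g.isCoarse.controlled _ (f.isCoarse.controlled M h)
    rwa [← image_comp, Prod.map_comp_map] at this,
    fun B h => f.isCoarse.proper _ (g.isCoarse.proper B h)⟩⟩

/-- A subset of a coarse space, as a coarse space. -/
def sub (X : CoarseSpace.{u}) (A : Set X.carrier) : CoarseSpace.{u} := ⟨A, X.str.sub A⟩

/-- The inclusion of a subspace. -/
def subIncl (X : CoarseSpace.{u}) (A : Set X.carrier) : X.sub A ⟶ X :=
  ⟨Subtype.val, ⟨fun M h => h, fun B h => by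
    apply CoarseStructure.bounded_of_prod
    refine X.str.subset (h.prod h) ?_
    rintro _ ⟨⟨a, b⟩, ⟨ha, hb⟩, rfl⟩
    exact ⟨ha, hb⟩⟩⟩

/-- The inclusion of a subspace in a larger one. -/
def inclOfLE (X : CoarseSpace.{u}) {A B : Set X.carrier} (h : A ⊆ B) : X.sub A ⟶ X.sub B :=
  ⟨Set.inclusion h, ⟨fun M hM => by
    refine X.str.subset hM ?_
    rintro _ ⟨_, ⟨q, hq, rfl⟩, rfl⟩
    exact ⟨q, hq, rfl⟩, fun S hS => by
    apply CoarseStructure.bounded_of_prod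
    refine X.str.subset (hS.prod hS) ?_
    rintro _ ⟨⟨a, b⟩, ⟨ha, hb⟩, rfl⟩
    exact ⟨(Set.inclusion h a, Set.inclusion h b), ⟨ha, hb⟩, rfl⟩⟩⟩

/-- The coarse disjoint union of coarse spaces. -/
def disjUnion {ι : Type u} (X : ι → CoarseSpace.{u}) : CoarseSpace.{u} :=
  ⟨Σ i, (X i).carrier, CoarseStructure.disjUnion fun i => (X i).str⟩

/-- The canonical inclusion in the coarse disjoint union. -/
def disjIncl {ι : Type u} (X : ι → CoarseSpace.{u}) (i : ι) : X i ⟶ disjUnion X :=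
  ⟨fun x => (⟨i, x⟩ : Σ i, (X i).carrier), by
    classical
    constructor
    · intro M hM
      refine ⟨fun j => if h : i = j then h ▸ M else {p | p.1 = p.2}, fun j => ∅, fun j => ?_,
        fun j => Or.inl rfl, ?_⟩
      · dsimp only
        split_ifs with h
        · subst h; exact hM
        · exact (X j).str.diag
      · rintro _ ⟨q, hq, rfl⟩
        exact Or.inl (mem_iUnion.2 ⟨i, q, by simpa using hq, rfl⟩)
    · intro B hB
      obtain ⟨N, C, hN, hC, h⟩ := CoarseStructure.Bounded.prod hB hB
      apply CoarseStructure.bounded_of_prod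
      refine (X i).str.subset ((X i).str.union (hN i) ((hC i).prod (hC i))) ?_
      rintro ⟨a, b⟩ ⟨ha, hb⟩
      rcases h (show ((⟨i, a⟩, ⟨i, b⟩) : (Σ i, (X i).carrier) × (Σ i, (X i).carrier)) ∈ B ×ˢ B
        from ⟨ha, hb⟩) with h | h
      · obtain ⟨j, ⟨c, d⟩, hq, e⟩ := mem_iUnion.1 h
        simp only [Prod.map_apply, Prod.mk.injEq] at e
        obtain ⟨e1, e2⟩ := e
        obtain ⟨rfl, e1⟩ := Sigma.mk.inj_iff.1 e1
        obtain rfl := eq_of_heq e1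
        obtain rfl := sigma_mk_injective e2
        exact Or.inl hq
      · obtain ⟨j, h⟩ := mem_iUnion.1 h
        obtain ⟨k, ⟨c, hc, e1⟩, ⟨d, hd, e2⟩⟩ := mem_iUnion.1 h
        obtain ⟨rfl, e1⟩ := Sigma.mk.inj_iff.1 e1
        obtain rfl := eq_of_heq e1
        obtain ⟨rfl, e2⟩ := Sigma.mk.inj_iff.1 e2
        obtain rfl := eq_of_heq e2
        exact Or.inr ⟨hc, hd⟩⟩

/-! ### Coarse homotopy -/

/-- Generalised rays: coarse structures on `[0,∞)` compatible with the topology, for which sums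
`M + N`, the sets `M^s` and translates `a + M` of controlled sets are controlled. -/
structure IsGeneralisedRay (r : CoarseStructure ℝ≥0) : Prop where
  compatible : r.CompatibleWithTopology
  add : ∀ M N, r.Controlled M → r.Controlled N →
    r.Controlled {q | ∃ m ∈ M, ∃ n ∈ N, q = (m.1 + n.1, m.2 + n.2)}
  between : ∀ M, r.Controlled M →
    r.Controlled {q | ∃ m ∈ M, m.1 ≤ q.1 ∧ q.1 ≤ m.2 ∧ m.1 ≤ q.2 ∧ q.2 ≤ m.2}
  translate : ∀ M, r.Controlled M → ∀ a : ℝ≥0,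
    r.Controlled {q | ∃ m ∈ M, q = (a + m.1, a + m.2)}

/-- The `p`-cylinder `I_p X`, as a subspace of the product `X × R`. -/
def cylinder (X : CoarseSpace.{u}) (r : CoarseStructure ℝ≥0) (p : X.carrier → ℝ≥0) :
    CoarseSpace.{u} :=
  CoarseSpace.sub ⟨X.carrier × ℝ≥0, X.str.prod r⟩ {q | q.2 ≤ p q.1 + 1}

/-- Elementary coarse homotopies. -/
def ElementaryHomotopic {X Y : CoarseSpace.{u}} (f₀ f₁ : X ⟶ Y) : Prop :=
  ∃ (r : CoarseStructure ℝ≥0) (p : X.carrier → ℝ≥0),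
    IsGeneralisedRay r ∧ IsCoarseMap X.str r p ∧
      ∃ H : X.cylinder r p ⟶ Y,
        (∀ x, f₀.toFun x = H.toFun ⟨(x, 0), bot_le (a := p x + 1)⟩) ∧
          ∀ x, f₁.toFun x = H.toFun ⟨(x, p x + 1), le_refl (p x + 1)⟩

/-- Coarsely homotopic maps: linked by a chain of elementary coarse homotopies. -/
def CoarselyHomotopic {X Y : CoarseSpace.{u}} (f₀ f₁ : X ⟶ Y) : Prop :=
  Relation.EqvGen ElementaryHomotopic f₀ f₁

/-- Coarse homotopy equivalences. -/
def IsCoarseHomotopyEquiv {X Y : CoarseSpace.{u}} (f : X ⟶ Y) : Prop :=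
  ∃ g : Y ⟶ X, CoarselyHomotopic (f ≫ g) (𝟙 X) ∧ CoarselyHomotopic (g ≫ f) (𝟙 Y)

/-- Flasque coarse spaces. -/
def Flasque (X : CoarseSpace.{u}) : Prop :=
  ∃ t : X.carrier → X.carrier,
    (∀ B, X.str.Bounded B → ∃ N : ℕ, ∀ n ≥ N, range t^[n] ∩ B = ∅) ∧
    (∀ M, X.str.Controlled M → X.str.Controlled (⋃ n : ℕ, Prod.map t^[n] t^[n] '' M)) ∧
    X.str.Close t id

/-- A coarsely excisive decomposition `X = A ∪ B`. -/
def CoarselyExcisiveDecomposition (X : CoarseSpace.{u}) (A B : Set X.carrier) : Prop :=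
  A ∪ B = univ ∧ ∀ m, X.str.Controlled m →
    ∃ M, X.str.Controlled M ∧ relImage m A ∩ relImage m B ⊆ relImage M (A ∩ B)

end CoarseSpace

open CoarseSpace in
/-- Coarsely excisive functors from the coarse category to the category of spectra. -/
structure IsCoarselyExcisive (E : CoarseSpace.{u} ⥤ TopSpectrum.{v}) : Prop where
  flasque : ∀ X : CoarseSpace.{u}, X.Flasque → (E.obj X).WeaklyContractible
  homotopy : ∀ (X Y : CoarseSpace.{u}) (f : X ⟶ Y), IsCoarseHomotopyEquiv f →
    TopSpectrum.Hom.IsWeakEquiv (E.map f)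
  excision : ∀ (X : CoarseSpace.{u}) (A B : Set X.carrier), X.CoarselyExcisiveDecomposition A B →
    TopSpectrum.IsHomotopyPushout
      (E.map (X.inclOfLE (A := A ∩ B) (B := A) inter_subset_left))
      (E.map (X.inclOfLE (A := A ∩ B) (B := B) inter_subset_right))
      (E.map (X.subIncl A)) (E.map (X.subIncl B))
  disjoint : ∀ (ι : Type u) (X : ι → CoarseSpace.{u}),
    TopSpectrum.Hom.IsWeakEquiv (TopSpectrum.wedgeDesc fun i => E.map (disjIncl X i))

/-! ### The open cone -/

section Cone

variable (X : Type u) [TopologicalSpace X]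

/-- The relation that collapses `X × {0}` to the apex of the cone. -/
inductive ConeRel : PUnit.{u + 1} ⊕ X × I → PUnit.{u + 1} ⊕ X × I → Prop
  | apex (x : X) : ConeRel (Sum.inr (x, 0)) (Sum.inl PUnit.unit)

/-- The closed cone `(X × [0,1]) / (X × {0})` (for empty `X`, the quotient is one point). -/
def Cone : Type u := Quot (ConeRel X)

instance : TopologicalSpace (Cone X) := inferInstanceAs (TopologicalSpace (Quot (ConeRel X)))

instance [CompactSpace X] : CompactSpace (Cone X) :=
  inferInstanceAs (CompactSpace (Quot (ConeRel X)))

variable {X}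

/-- The point `[x, t]` of the cone. -/
def Cone.mk (x : X) (t : I) : Cone X := Quot.mk _ (Sum.inr (x, t))

/-- The coordinate `[x, t] ↦ t`. -/
def Cone.height : Cone X → I :=
  Quot.lift (Sum.elim (fun _ => 0) Prod.snd) (by rintro _ _ ⟨x⟩; rfl)

theorem Cone.continuous_height : Continuous (Cone.height (X := X)) :=
  continuous_quot_lift _ (continuous_sum_dom.2 ⟨continuous_const, continuous_snd⟩)

/-- The points `[x, t]` with `x ∈ U` and `t > 0`. -/
def Cone.over (U : Set X) : Set (Cone X) :=
  {c | Quot.lift (Sum.elim (fun _ => False) (fun p : X × I => p.1 ∈ U ∧ 0 < p.2))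
    (by rintro _ _ ⟨x⟩; simp) c}

theorem Cone.isOpen_over {U : Set X} (hU : IsOpen U) : IsOpen (Cone.over U) := by
  refine isOpen_coinduced.2 (isOpen_sum_iff.2 ⟨?_, ?_⟩)
  · exact isOpen_empty
  · exact (hU.preimage continuous_fst).inter
      (isOpen_lt continuous_const continuous_snd : IsOpen {p : X × I | (0 : I) < p.2})

instance [T2Space X] : T2Space (Cone X) where
  t2 := by
    intro c d hcd
    by_cases h : c.height = d.height
    · have key : ∀ e : Cone X, e = Quot.mk _ (Sum.inl PUnit.unit) ∨
          ∃ x t, 0 < t ∧ e = Cone.mk x t := by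
        intro e
        induction e using Quot.ind with | mk p => ?_
        rcases p with _ | ⟨x, t⟩
        · exact Or.inl rfl
        · rcases eq_or_ne t 0 with rfl | ht
          · exact Or.inl (Quot.sound (ConeRel.apex x))
          · exact Or.inr ⟨x, t, unitInterval.pos_iff_ne_zero.2 ht, rfl⟩
      rcases key c with rfl | ⟨x, t, ht, rfl⟩ <;> rcases key d with rfl | ⟨y, r, hr, rfl⟩
      · exact absurd rfl hcd
      · exact absurd h hr.ne
      · exact absurd h.symm ht.ne
      · obtain rfl : t = r := h
        have hxy : x ≠ y := by rintro rfl; exact hcd rfl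
        obtain ⟨U, V, hU, hV, hx, hy, hUV⟩ := t2_separation hxy
        refine ⟨_, _, Cone.isOpen_over hU, Cone.isOpen_over hV, ⟨hx, ht⟩, ⟨hy, hr⟩, ?_⟩
        refine Set.disjoint_left.2 fun e => ?_
        induction e using Quot.ind with | mk p => ?_
        rcases p with _ | ⟨z, q⟩
        · exact fun h => h.elim
        · exact fun h h' => Set.disjoint_left.1 hUV h.1 h'.1
    · obtain ⟨U, V, hU, hV, hx, hy, hUV⟩ := t2_separation h
      exact ⟨_, _, hU.preimage Cone.continuous_height, hV.preimage Cone.continuous_height, hx, hy,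
        hUV.preimage _⟩

/-- The map of closed cones induced by a continuous map. -/
def Cone.map {Y : Type u} [TopologicalSpace Y] (f : C(X, Y)) : Cone X → Cone Y :=
  Quot.map (Sum.map id (Prod.map f id)) (by rintro _ _ ⟨x⟩; exact ConeRel.apex (f x))

theorem Cone.continuous_map {Y : Type u} [TopologicalSpace Y] (f : C(X, Y)) :
    Continuous (Cone.map f) :=
  continuous_quot_lift _ (continuous_quot_mk.comp
    (continuous_id.sumMap (f.continuous.prodMap continuous_id)))

theorem Cone.height_map {Y : Type u} [TopologicalSpace Y] (f : C(X, Y)) (c : Cone X) :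
    (Cone.map f c).height = c.height := by
  induction c using Quot.ind with | mk p => ?_
  rcases p with _ | ⟨x, t⟩ <;> rfl

variable (X) in
/-- The underlying set of the open cone `(X × [0,1)) / (X × {0})`, inside the closed cone. -/
def OpenCone : Type u := {c : Cone X // c.height < 1}

/-- A subset of `𝒪X × 𝒪X` as a subset of the square of the compactification. -/
def OpenCone.lift (M : Set (OpenCone X × OpenCone X)) : Set (Cone X × Cone X) :=
  (fun p => (p.1.1, p.2.1)) '' M

variable (X) in
/-- The continuously controlled coarse structure on the open cone: `M` is controlled if its closure
in the square of the compactification meets the pairs with at least one point at infinity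
(height `1`) only in the diagonal. -/
def continuouslyControlled [CompactSpace X] [T2Space X] : CoarseStructure (OpenCone X) where
  Controlled M := ∀ p ∈ closure (OpenCone.lift M), p.1.height = 1 ∨ p.2.height = 1 → p.1 = p.2
  union {M N} h k p hp := by
    rw [OpenCone.lift, image_union, closure_union] at hp
    exact hp.elim (h p) (k p)
  subset h k p hp := h p (closure_mono (image_mono k) hp)
  symm {M} h p hp hb := by
    refine (h p.swap ?_ hb.symm).symm
    have := map_mem_closure continuous_swap hp (t := OpenCone.lift M) (by
      rintro _ ⟨q, hq, rfl⟩
      exact ⟨q.swap, hq, rfl⟩)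
    exact this
  comp {M N} h k := by
    rintro ⟨a, c⟩ hp hb
    obtain ⟨F, hF, hlim⟩ := mem_closure_iff_ultrafilter.1 hp
    have hex : ∀ q : Cone X × Cone X, ∃ y : Cone X, q ∈ OpenCone.lift (relComp M N) →
        (q.1, y) ∈ OpenCone.lift M ∧ (y, q.2) ∈ OpenCone.lift N := by
      intro q
      by_cases hq : q ∈ OpenCone.lift (relComp M N)
      · obtain ⟨p, ⟨y, hy, hy'⟩, rfl⟩ := hq
        exact ⟨y.1, fun _ => ⟨⟨_, hy, rfl⟩, ⟨_, hy', rfl⟩⟩⟩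
      · exact ⟨q.1, fun h => absurd h hq⟩
    choose y hy using hex
    obtain ⟨b, -, hb'⟩ := isCompact_univ.ultrafilter_le_nhds (F.map y) (by simp)
    have hyb : Filter.Tendsto y F (𝓝 b) := hb'
    have h1 : Filter.Tendsto (fun q : Cone X × Cone X => q.1) F (𝓝 a) :=
      (continuous_fst.tendsto (a, c)).mono_left hlim
    have h2 : Filter.Tendsto (fun q : Cone X × Cone X => q.2) F (𝓝 c) :=
      (continuous_snd.tendsto (a, c)).mono_left hlim
    have hab : (a, b) ∈ closure (OpenCone.lift M) :=
      mem_closure_of_tendsto (h1.prodMk_nhds hyb)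
        (Filter.mem_of_superset hF fun q hq => (hy q hq).1)
    have hbc : (b, c) ∈ closure (OpenCone.lift N) :=
      mem_closure_of_tendsto (hyb.prodMk_nhds h2)
        (Filter.mem_of_superset hF fun q hq => (hy q hq).2)
    rcases hb with ha | hc
    · have e : a = b := h _ hab (Or.inl ha)
      subst e
      exact k _ hbc (Or.inl ha)
    · have e : b = c := k _ hbc (Or.inr hc)
      subst e
      exact h _ hab (Or.inr hc)
  diag p hp _ := by
    have : closure (OpenCone.lift {p : OpenCone X × OpenCone X | p.1 = p.2}) ⊆
        {p : Cone X × Cone X | p.1 = p.2} := by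
      refine closure_minimal ?_ (isClosed_eq continuous_fst continuous_snd)
      rintro _ ⟨q, hq, rfl⟩
      exact congrArg Subtype.val hq
    exact this hp
  connected x y := by
    refine ⟨{(x, y)}, fun p hp hb => ?_, rfl⟩
    rw [OpenCone.lift, image_singleton, closure_singleton, mem_singleton_iff] at hp
    subst hp
    exact (hb.elim x.2.ne y.2.ne).elim

end Cone

/-- The open cone `𝒪X` of a compact Hausdorff space, as a coarse space. -/
def openCone (X : CompHaus.{u}) : CoarseSpace.{u} := ⟨OpenCone X, continuouslyControlled X⟩

/-- The map of open cones induced by a continuous map, `[x, t] ↦ [f x, t]`, is coarse. -/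
def openConeMap {X Y : CompHaus.{u}} (f : X ⟶ Y) : openCone X ⟶ openCone Y :=
  ⟨fun c => ⟨Cone.map f.hom.hom c.1, by rw [Cone.height_map]; exact c.2⟩, by
    have key : ∀ M : Set (OpenCone X × OpenCone X),
        closure (OpenCone.lift (Prod.map
          (fun c : OpenCone X => (⟨Cone.map f.hom.hom c.1, by rw [Cone.height_map]; exact c.2⟩ :
            OpenCone Y))
          (fun c : OpenCone X => (⟨Cone.map f.hom.hom c.1, by rw [Cone.height_map]; exact c.2⟩ :
            OpenCone Y)) '' M)) ⊆
        Prod.map (Cone.map f.hom.hom) (Cone.map f.hom.hom) '' closure (OpenCone.lift M) := by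
      intro M
      have hc : Continuous (Prod.map (Cone.map f.hom.hom) (Cone.map f.hom.hom)) :=
        (Cone.continuous_map _).prodMap (Cone.continuous_map _)
      refine closure_minimal ?_ (isClosed_closure.isCompact.image hc).isClosed
      rintro _ ⟨_, ⟨q, hq, rfl⟩, rfl⟩
      exact ⟨_, subset_closure ⟨q, hq, rfl⟩, rfl⟩
    constructor
    · intro M hM p hp hb
      obtain ⟨q, hq, rfl⟩ := key M hp
      simp only [Prod.map_fst, Prod.map_snd, Cone.height_map] at hb ⊢
      rw [hM q hq hb]
    · intro B hB
      apply CoarseStructure.bounded_of_prod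
      have hB' := hB.prod hB
      have aux : ∀ c ∈ closure (Subtype.val '' (B : Set (OpenCone Y)) : Set (Cone Y)),
          Cone.height c ≠ 1 := by
        intro c hc h1
        rcases hB with rfl | ⟨x, hx⟩
        · obtain ⟨_, ⟨b, hb, -⟩⟩ := closure_nonempty_iff.1 ⟨c, hc⟩
          exact hb
        · have : (c, x.1) ∈ closure (OpenCone.lift (B ×ˢ {x})) := by
            have hcont : Continuous fun d : Cone Y => (d, x.1) := by fun_prop
            refine map_mem_closure (f := fun d : Cone Y => (d, x.1)) hcont hc ?_
            rintro _ ⟨b, hb, rfl⟩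
            exact ⟨(b, x), ⟨hb, rfl⟩, rfl⟩
          have e : c = x.1 := hx _ this (Or.inl h1)
          rw [e] at h1
          exact x.2.ne h1
      intro p hp hb
      exfalso
      rcases hb with hb | hb
      · refine aux (Cone.map f.hom.hom p.1) ?_ (by rw [Cone.height_map]; exact hb)
        refine map_mem_closure (f := fun q : Cone X × Cone X => Cone.map f.hom.hom q.1)
          ((Cone.continuous_map _).comp continuous_fst) hp ?_
        rintro _ ⟨q, hq, rfl⟩
        exact ⟨_, hq.1, rfl⟩
      · refine aux (Cone.map f.hom.hom p.2) ?_ (by rw [Cone.height_map]; exact hb)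
        refine map_mem_closure (f := fun q : Cone X × Cone X => Cone.map f.hom.hom q.2)
          ((Cone.continuous_map _).comp continuous_snd) hp ?_
        rintro _ ⟨q, hq, rfl⟩
        exact ⟨_, hq.2, rfl⟩⟩

/-- The open cone, as a functor from compact Hausdorff spaces to the coarse category. -/
def openConeFunctor : CompHaus.{u} ⥤ CoarseSpace.{u} where
  obj := openCone
  map := openConeMap
  map_id X := by
    apply CoarseSpace.Hom.ext
    funext c
    apply Subtype.ext
    rcases c with ⟨c, hc⟩
    induction c using Quot.ind with | mk p => ?_
    rcases p with _ | ⟨x, t⟩ <;> rfl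
  map_comp f g := by
    apply CoarseSpace.Hom.ext
    funext c
    apply Subtype.ext
    rcases c with ⟨c, hc⟩
    induction c using Quot.ind with | mk p => ?_
    rcases p with _ | ⟨x, t⟩ <;> rfl

/-- The open cone `𝒪U ⊆ 𝒪X` over a subset `U ⊆ X`: the apex and all `[x, t]` with `x ∈ U`. -/
def openConeOver (X : CompHaus.{u}) (U : Set X) : Set (openCone X).carrier :=
  {c | Cone.height c.1 = 0 ∨ ∃ x ∈ U, ∃ t, c.1 = Cone.mk x t}

theorem openConeOver_mono (X : CompHaus.{u}) {U V : Set X} (h : U ⊆ V) :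
    openConeOver X U ⊆ openConeOver X V := by
  rintro c (hc | ⟨x, hx, t, ht⟩)
  · exact Or.inl hc
  · exact Or.inr ⟨x, h hx, t, ht⟩

/-- The compact Hausdorff spaces that are homotopy equivalent to CW-complexes. -/
def hasCWType : ObjectProperty CompHaus.{u} := fun X =>
  ∃ (Y : Type u) (_ : TopologicalSpace Y) (_ : T2Space Y),
    Nonempty (Topology.CWComplex (univ : Set Y)) ∧ Nonempty (ContinuousMap.HomotopyEquiv X Y)

/-- The functor `X ↦ E(𝒪X)` on compact Hausdorff spaces homotopy equivalent to CW-complexes. -/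
def coneTheory (E : CoarseSpace.{u} ⥤ TopSpectrum.{v}) :
    hasCWType.{u}.FullSubcategory ⥤ TopSpectrum.{v} :=
  hasCWType.ι ⋙ openConeFunctor ⋙ E

/-! The hard point is homotopy invariance. A homotopy `F` of maps `X → Y` suggests a coarse homotopy
of open cones that runs through `F` at speed `1 / (level + 1)`. On the open cone this fails to be
controlled: continuously controlled sets may relate points on a ray whose levels differ by arbitrary
amounts, so the time in `F` jumps. It works on `coneGraph X`, the graph of the level function in `𝒪X
× [0,∞)` with the metric ray as second factor. Related points there have levels at bounded distance,
so the time changes by `O(1 / level)`, which vanishes at infinity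
(`coneGraph.elementaryHomotopic_map`). Homotopy equivalences therefore induce coarse homotopy
equivalences of graphs.

The graph is compared with the cone as follows. The space `𝒪X × [0,∞)` is flasque, and the parts
below and above the graph form a coarsely excisive decomposition with the graph as intersection. In
a homotopy pushout with weakly contractible corner, `π_k A → π_k B` is onto
(`IsHomotopyPushout.mapPi_surjective`, by an explicit piece of the Puppe sequence). The projection
from the part below the graph to the cone has a section, so the projection from the graph to the
cone is onto on `π_k`. By naturality every homotopy equivalence `X → Y` is onto on `π_k`.

Surjectivity suffices. Applied to an end inclusion `X → I × X`, which is split by the projection, it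
makes the projection injective on `π_k`. Hence both end inclusions induce the same map, homotopic
maps agree on `π_k`, and homotopy equivalences become bijections.

For excision, the complements of `U` and `V` are disjoint and closed, so a controlled set joins the
cones over them only in a bounded region; the cones over `U` and `V` are then a coarsely excisive
decomposition. For disjoint unions, compactness leaves finitely many nonempty summands, and `𝒪(∐
X_i)` differs from `⋁ 𝒪X_i` only in that the apexes are identified. This does not matter up to
closeness, and close maps are coarsely homotopic. The empty union needs `E(𝒪∅)` to be weakly
contractible, which follows from `∅ = ∅ ⊔ ∅`. -/

namespace TopSpectrum

/-! ### Maps on stable homotopy groups, and stably trivial classes. -/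

section MapPi

variable {A : TopSpectrum.{u}} {B : TopSpectrum.{v}} {C : TopSpectrum.{w}}

/-- The factorisation is required pointwise rather than as an equation of morphisms, because a wedge
may lie in another universe, where categorical composition is not available. -/
theorem Hom.mapPi_comp_of_app (f : Hom A B) (g : Hom B C) (h : Hom A C)
    (H : ∀ n x, h.app n x = g.app n (f.app n x)) (k : ℤ) :
    h.mapPi k = g.mapPi k ∘ f.mapPi k := by
  funext a
  induction a using Quot.ind with | mk r => ?_
  refine congrArg (Quot.mk _) ?_
  unfold Hom.mapRep
  congr 1
  apply Subtype.ext
  ext y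
  exact H _ _

theorem Hom.mapPi_eq_id (h : Hom A A) (H : ∀ n x, h.app n x = x) (k : ℤ) :
    h.mapPi k = id := by
  funext a
  induction a using Quot.ind with | mk r => ?_
  refine congrArg (Quot.mk _) ?_
  unfold Hom.mapRep
  congr 1
  apply Subtype.ext
  ext y
  exact H _ _

/-- The generalised loop induced by a map of spectra. -/
def Hom.mapLoop (f : Hom A B) {n m : ℕ} (γ : GenLoop (Fin m) (A.space n) (A.pt n)) :
    GenLoop (Fin m) (B.space n) (B.pt n) :=
  ⟨(f.app n).comp γ.1, fun y hy => by
    have h : γ.1 y = A.pt n := γ.2 y hy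
    simp [h, f.app_pt]⟩

end MapPi

theorem mapPi_id (A : TopSpectrum.{v}) (k : ℤ) : Hom.mapPi (𝟙 A) k = id :=
  Hom.mapPi_eq_id _ (fun _ _ => rfl) k

section Null

variable (A : TopSpectrum.{v})

/-- The constant generalised loop at the base point. -/
def constLoop (n m : ℕ) : GenLoop (Fin m) (A.space n) (A.pt n) :=
  ⟨ContinuousMap.const _ (A.pt n), fun _ _ => rfl⟩

theorem stab_constLoop (n m : ℕ) : A.stab (A.constLoop n m) = A.constLoop (n + 1) (m + 1) := by
  apply Subtype.ext
  ext y
  exact A.adj_pt n _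

variable {A}

theorem stab_homotopic {n m : ℕ} {γ γ' : GenLoop (Fin m) (A.space n) (A.pt n)}
    (h : GenLoop.Homotopic γ γ') : GenLoop.Homotopic (A.stab γ) (A.stab γ') := by
  obtain ⟨F⟩ := h
  refine ⟨{ toFun := fun p => A.adj n (F (p.1, Fin.tail p.2)) (p.2 0)
            continuous_toFun := ?_
            map_zero_left := fun y => ?_
            map_one_left := fun y => ?_
            prop' := fun t y hy => ?_ }⟩
  · have h : Continuous fun y : Fin (m + 1) → I => (Fin.tail y : Fin m → I) :=
      continuous_pi fun i => continuous_apply _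
    fun_prop
  · exact congrArg (fun a => A.adj n a (y 0)) (F.map_zero_left _)
  · exact congrArg (fun a => A.adj n a (y 0)) (F.map_one_left _)
  · obtain ⟨i, hi⟩ := hy
    change A.adj n (F (t, Fin.tail y)) (y 0) = A.adj n (γ.1 (Fin.tail y)) (y 0)
    refine Fin.cases (fun hi => ?_) (fun j hj => ?_) i hi
    · rcases hi with hi | hi
      · rw [hi, A.adj_zero, A.adj_zero]
      · rw [hi, A.adj_one, A.adj_one]
    · rw [F.eq_fst t (x := Fin.tail y) ⟨j, hj⟩]

variable (A) in
/-- A generalised loop that becomes null homotopic after `j` stabilizations. -/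
def NullAfter : ∀ (_ n m : ℕ), GenLoop (Fin m) (A.space n) (A.pt n) → Prop
  | 0, n, m, γ => GenLoop.Homotopic γ (A.constLoop n m)
  | j + 1, n, m, γ => NullAfter j (n + 1) (m + 1) (A.stab γ)

theorem NullAfter.congr : ∀ {j n m : ℕ} {γ γ' : GenLoop (Fin m) (A.space n) (A.pt n)},
    GenLoop.Homotopic γ γ' → NullAfter A j n m γ → NullAfter A j n m γ'
  | 0, _, _, _, _, h, h0 => h.symm.trans h0
  | j + 1, _, _, _, _, h, h0 => NullAfter.congr (j := j) (stab_homotopic h) h0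

theorem NullAfter.succ : ∀ {j n m : ℕ} {γ : GenLoop (Fin m) (A.space n) (A.pt n)},
    NullAfter A j n m γ → NullAfter A (j + 1) n m γ
  | 0, n, m, γ, h => by
    have := stab_homotopic h
    rwa [stab_constLoop] at this
  | j + 1, _, _, _, h => NullAfter.succ (j := j) h

/-- Becoming null after some number of stabilizations is invariant under both generators of
`StableRel`, so it descends to a predicate on `StablePi`. This avoids following zigzags of
generators. -/
theorem exists_nullAfter_of_mk_eq_constLoop {k : ℤ} {n m : ℕ} (h : (m : ℤ) = n + k)
    (γ : GenLoop (Fin m) (A.space n) (A.pt n))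
    (e : (Quot.mk _ ⟨n, m, h, γ⟩ : StablePi A k) = Quot.mk _ ⟨n, m, h, A.constLoop n m⟩) :
    ∃ j, NullAfter A j n m γ := by
  let P : StablePi A k → Prop := Quot.lift (fun r => ∃ j, NullAfter A j r.n r.m r.loop) (by
    rintro _ _ (⟨n, m, h, γ, γ', H⟩ | ⟨n, m, h, γ⟩)
    · exact propext ⟨fun ⟨j, hj⟩ => ⟨j, hj.congr H⟩, fun ⟨j, hj⟩ => ⟨j, hj.congr H.symm⟩⟩
    · exact propext ⟨fun ⟨j, hj⟩ => ⟨j, hj.succ⟩, fun ⟨j, hj⟩ => ⟨j + 1, hj⟩⟩)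
  have hP : P (Quot.mk _ ⟨n, m, h, A.constLoop n m⟩) := ⟨0, GenLoop.Homotopic.refl _⟩
  rw [← e] at hP
  exact hP

end Null

/-! ### The connecting map of a double mapping cylinder. -/

section Surjectivity

variable {A B C D : TopSpectrum.{v}} (f : A ⟶ B) (g : A ⟶ C)

/-- The inclusion of the left end in the double mapping cylinder. -/
def cylLeft : B ⟶ cyl f g where
  app n := ⟨fun b => Quot.mk _ (Sum.inl (Sum.inl b)), by fun_prop⟩
  app_pt _ := rfl
  app_adj _ _ _ := rfl

/-- The connecting map of the double mapping cylinder, which collapses both ends and is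
`(a, τ) ↦ adj a τ` on the cylinder. -/
def cylConnecting (n : ℕ) : C((cyl f g).space n, A.space (n + 1)) where
  toFun := Quot.lift (Sum.elim (fun _ => A.pt (n + 1)) (fun p => A.adj n p.1 p.2)) (by
    rintro _ _ (a | a | t)
    · exact A.adj_zero n a
    · exact A.adj_one n a
    · exact A.adj_pt n t)
  continuous_toFun := continuous_quot_lift _ (by
    refine continuous_sum_dom.2 ⟨continuous_const, ?_⟩
    change Continuous fun p : A.space n × I => A.adj n p.1 p.2
    fun_prop)

/-- A contraction of the composite of the connecting map with `f`, which on the left end is the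
adjoint structure map of `B`. -/
def cylContraction (n : ℕ) : C((cyl f g).space n, C(I, B.space (n + 1))) where
  toFun := Quot.lift
    (Sum.elim (Sum.elim (B.adj n) (fun _ => ContinuousMap.const I (B.pt (n + 1))))
      -- The maximum of cylinder coordinate and contraction parameter serves as loop time. At
      -- parameter `0` this is the composite with `f`, at parameter `1` the end of the loop. On the
      -- left end, where the coordinate is `0`, the whole loop is traversed.
      (fun p => (⟨fun q : (A.space n × I) × I => B.adj n (f.app n q.1.1) (q.1.2 ⊔ q.2),
        by fun_prop⟩ : C((A.space n × I) × I, B.space (n + 1))).curry p)) (by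
    rintro _ _ (a | a | t)
    · ext s
      change B.adj n (f.app n a) (0 ⊔ s) = B.adj n (f.app n a) s
      rw [sup_eq_right.2 nonneg']
    · ext s
      change B.adj n (f.app n a) (1 ⊔ s) = B.pt (n + 1)
      rw [sup_eq_left.2 le_one', B.adj_one]
    · ext s
      change B.adj n (f.app n (A.pt n)) (t ⊔ s) = B.adj n (B.pt n) s
      rw [f.app_pt, B.adj_pt, B.adj_pt])
  continuous_toFun := continuous_quot_lift _ (by
    refine continuous_sum_dom.2 ⟨continuous_sum_dom.2 ⟨?_, continuous_const⟩,
      ContinuousMap.continuous _⟩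
    exact (B.adj n).continuous)

theorem cylContraction_zero (n : ℕ) (z : (cyl f g).space n) :
    cylContraction f g n z 0 = f.app (n + 1) (cylConnecting f g n z) := by
  induction z using Quot.ind with | mk p => ?_
  rcases p with (b | c) | ⟨a, t⟩
  · exact (B.adj_zero n b).trans (f.app_pt _).symm
  · exact (f.app_pt _).symm
  · change B.adj n (f.app n a) (t ⊔ 0) = f.app (n + 1) (A.adj n a t)
    rw [sup_eq_left.2 nonneg', f.app_adj]

theorem cylContraction_one (n : ℕ) (z : (cyl f g).space n) :
    cylContraction f g n z 1 = B.pt (n + 1) := by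
  induction z using Quot.ind with | mk p => ?_
  rcases p with (b | c) | ⟨a, t⟩
  · exact B.adj_one n b
  · rfl
  · change B.adj n (f.app n a) (t ⊔ 1) = _
    rw [sup_eq_right.2 le_one', B.adj_one]

/-- The null homotopy `Γ` in the cylinder, followed by the connecting map, is a cube of one
dimension more in `A.space (n + 1)`; this is `δ`. The contraction `cylContraction` deforms its image
under `f` into `B.stab γ`. -/
theorem exists_homotopic_stab_of_cylLeft_null {n m : ℕ}
    (γ : GenLoop (Fin m) (B.space n) (B.pt n))
    (hγ : GenLoop.Homotopic ((cylLeft f g).mapLoop γ) ((cyl f g).constLoop n m)) :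
    ∃ δ : GenLoop (Fin (m + 1)) (A.space (n + 1)) (A.pt (n + 1)),
      GenLoop.Homotopic (Hom.mapLoop f δ) (B.stab γ) := by
  obtain ⟨Γ⟩ := hγ
  have htail : Continuous fun y : Fin (m + 1) → I => (Fin.tail y : Fin m → I) :=
    continuous_pi fun i => continuous_apply _
  have Γ_zero : ∀ y, Γ (0, y) = (cylLeft f g).app n (γ.1 y) := Γ.map_zero_left
  have Γ_one : ∀ y, Γ (1, y) = (cyl f g).pt n := Γ.map_one_left
  have Γ_bdry : ∀ t, ∀ y ∈ Cube.boundary (Fin m), Γ (t, y) = (cyl f g).pt n := fun t y hy => by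
    rw [Γ.eq_snd t hy]; rfl
  have K_pt : ∀ s, cylContraction f g n ((cyl f g).pt n) s = B.pt (n + 1) := B.adj_pt n
  have κ_cont := (cylConnecting f g n).continuous
  have K_cont := (cylContraction f g n).continuous
  let δ : GenLoop (Fin (m + 1)) (A.space (n + 1)) (A.pt (n + 1)) :=
    ⟨⟨fun y => cylConnecting f g n (Γ (y 0, Fin.tail y)),
      κ_cont.comp (Γ.continuous.comp ((continuous_apply 0).prodMk htail))⟩, by
      rintro y ⟨i, hi⟩
      change cylConnecting f g n (Γ (y 0, Fin.tail y)) = _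
      refine Fin.cases (fun hi => ?_) (fun j hj => ?_) i hi
      · rcases hi with hi | hi
        · rw [hi, Γ_zero]; rfl
        · rw [hi, Γ_one]; rfl
      · rw [Γ_bdry _ _ ⟨j, hj⟩]; rfl⟩
  -- The path `(a, b)` runs along two edges of the unit square, from `(1, 0)` through `(1, 1)` to
  -- `(0, 1)`. The first argument scales the time in `Γ`, the second the contraction parameter. At
  -- all times one of them is `1`, which keeps the face `y 0 = 1` at the base point: either `Γ` or
  -- the contraction has reached its end.
  let a : I → I := fun θ => Set.projIcc 0 1 zero_le_one (2 - 2 * (θ : ℝ))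
  let b : I → I := fun θ => Set.projIcc 0 1 zero_le_one (2 * (θ : ℝ))
  have ha : Continuous a := continuous_projIcc.comp (by fun_prop)
  have hb : Continuous b := continuous_projIcc.comp (by fun_prop)
  have a0 : a 0 = 1 := Set.projIcc_of_right_le _ (by norm_num)
  have a1 : a 1 = 0 := Set.projIcc_of_le_left _ (by norm_num)
  have b0 : b 0 = 0 := Set.projIcc_of_le_left _ (by norm_num)
  have b1 : b 1 = 1 := Set.projIcc_of_right_le _ (by norm_num)
  have hab : ∀ θ, a θ = 1 ∨ b θ = 1 := fun θ => by
    rcases le_total (θ : ℝ) (1 / 2) with hθ | hθ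
    · exact Or.inl (Set.projIcc_of_right_le _ (by linarith))
    · exact Or.inr (Set.projIcc_of_right_le _ (by linarith))
  refine ⟨δ, ⟨{ toFun := fun p => cylContraction f g n (Γ (p.2 0 * a p.1, Fin.tail p.2))
                  (p.2 0 * b p.1)
                continuous_toFun := ?_
                map_zero_left := fun y => ?_
                map_one_left := fun y => ?_
                prop' := fun t y hy => ?_ }⟩⟩
  · have h1 : Continuous fun p : I × (Fin (m + 1) → I) => Γ (p.2 0 * a p.1, Fin.tail p.2) :=
      Γ.continuous.comp (by fun_prop)
    exact (K_cont.comp h1).eval (by fun_prop)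
  · change cylContraction f g n (Γ (y 0 * a 0, Fin.tail y)) (y 0 * b 0) = _
    rw [a0, b0, mul_one, mul_zero, cylContraction_zero]
    rfl
  · change cylContraction f g n (Γ (y 0 * a 1, Fin.tail y)) (y 0 * b 1) = _
    rw [a1, b1, mul_one, mul_zero, Γ_zero]
    rfl
  · refine Eq.trans ?_ ((Hom.mapLoop f δ).2 y hy).symm
    obtain ⟨i, hi⟩ := hy
    change cylContraction f g n (Γ (y 0 * a t, Fin.tail y)) (y 0 * b t) = B.pt (n + 1)
    refine Fin.cases (fun hi => ?_) (fun j hj => ?_) i hi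
    · rcases hi with hi | hi
      · rw [hi, zero_mul, zero_mul, Γ_zero]
        exact B.adj_zero n _
      · rcases hab t with e | e
        · rw [hi, e, one_mul, Γ_one, K_pt]
        · rw [hi, e, one_mul, one_mul, cylContraction_one]
    · rw [Γ_bdry _ _ ⟨j, hj⟩, K_pt]

theorem mk_mem_range_of_nullAfter {k : ℤ} : ∀ {j n m : ℕ} (h : (m : ℤ) = n + k)
    (γ : GenLoop (Fin m) (B.space n) (B.pt n)),
    NullAfter (cyl f g) j n m ((cylLeft f g).mapLoop γ) →
    (Quot.mk _ ⟨n, m, h, γ⟩ : StablePi B k) ∈ range (Hom.mapPi f k)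
  | 0, n, m, h, γ, hγ => by
    obtain ⟨δ, hδ⟩ := exists_homotopic_stab_of_cylLeft_null f g γ hγ
    refine ⟨Quot.mk _ ⟨n + 1, m + 1, by push_cast; omega, δ⟩, ?_⟩
    refine (Quot.sound (StableRel.homotopy _ _ _ _ _ hδ)).trans ?_
    exact (Quot.sound (StableRel.stab n m h γ)).symm
  | j + 1, n, m, h, γ, hγ => by
    rw [Quot.sound (StableRel.stab n m h γ)]
    -- Stabilization commutes definitionally with the inclusion of the left end, so `hγ` already has
    -- the required type.
    exact mk_mem_range_of_nullAfter (j := j) _ (B.stab γ) hγ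

/-- In a homotopy push-out square with weakly contractible fourth corner, the map
`π_k A → π_k B` is surjective. -/
theorem IsHomotopyPushout.mapPi_surjective {f : A ⟶ B} {g : A ⟶ C} {h : B ⟶ D} {l : C ⟶ D}
    (H : IsHomotopyPushout f g h l) (hD : D.WeaklyContractible) (k : ℤ) :
    Function.Surjective (Hom.mapPi f k) := by
  obtain ⟨e, he⟩ := H
  intro b
  induction b using Quot.ind with | mk r => ?_
  obtain ⟨n, m, hr, γ⟩ := r
  have := hD k
  -- The image of the class in the cylinder is trivial, because `π_k` of the cylinder embeds in the
  -- trivial `π_k D`.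
  obtain ⟨j, hj⟩ := exists_nullAfter_of_mk_eq_constLoop hr
    ((cylLeft f g).mapLoop γ) ((he k).1 (Subsingleton.elim _ _))
  exact mk_mem_range_of_nullAfter f g hr γ hj

end Surjectivity

end TopSpectrum

/-! ### Limits along ultrafilters. -/

open Filter in
theorem Ultrafilter.exists_tendsto_of_compactSpace {α : Type u} {K : Type v} [TopologicalSpace K]
    [CompactSpace K] (F : Ultrafilter α) (k : α → K) : ∃ a, Tendsto k F (𝓝 a) := by
  obtain ⟨a, -, ha⟩ := isCompact_univ.ultrafilter_le_nhds (F.map k) (by simp)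
  exact ⟨a, ha⟩

-- The ultrafilter is pulled back to the index type, so that any further data attached to the
-- indices can be passed to the limit along it too.
open Filter in
theorem exists_ultrafilter_tendsto_of_mem_closure_image {α : Type u} {K : Type v}
    [TopologicalSpace K] {k : α → K} {S : Set α} {p : K} (hp : p ∈ closure (k '' S)) :
    ∃ F : Ultrafilter α, S ∈ F ∧ Tendsto k F (𝓝 p) := by
  obtain ⟨G, hG, hlim⟩ := mem_closure_iff_ultrafilter.1 hp
  refine ⟨Ultrafilter.ofComapInfPrincipal hG, Ultrafilter.ofComapInfPrincipal_mem hG, ?_⟩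
  rw [Tendsto, ← Ultrafilter.coe_map, Ultrafilter.ofComapInfPrincipal_eq_of_map hG]
  exact hlim

/-! ### The metric ray and the proper ray. -/

namespace CoarseStructure

theorem controlled_biUnion {X : Type u} (s : CoarseStructure X) {ι : Type v} {F : Set ι}
    (hF : F.Finite) (M : ι → Set (X × X)) (h : ∀ i ∈ F, s.Controlled (M i)) :
    s.Controlled (⋃ i ∈ F, M i) := by
  induction F, hF using Set.Finite.induction_on with
  | empty => exact s.subset s.diag (by simp)
  | insert _ _ ih =>
    rw [biUnion_insert]
    exact s.union (h _ (mem_insert _ _)) (ih fun i hi => h i (mem_insert_of_mem _ hi))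

/-- The metric coarse structure on `[0,∞)`. -/
def metricRay : CoarseStructure ℝ≥0 where
  Controlled M := ∃ C, ∀ p ∈ M, p.1 ≤ p.2 + C ∧ p.2 ≤ p.1 + C
  union := by
    rintro M N ⟨C, hC⟩ ⟨D, hD⟩
    refine ⟨C + D, ?_⟩
    rintro p (hp | hp)
    · exact ⟨(hC p hp).1.trans (by gcongr; exact le_self_add),
        (hC p hp).2.trans (by gcongr; exact le_self_add)⟩
    · exact ⟨(hD p hp).1.trans (by gcongr; exact le_add_self),
        (hD p hp).2.trans (by gcongr; exact le_add_self)⟩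
  subset := by
    rintro M N ⟨C, hC⟩ h
    exact ⟨C, fun p hp => hC p (h hp)⟩
  symm := by
    rintro M ⟨C, hC⟩
    exact ⟨C, fun p hp => (hC _ hp).symm⟩
  comp := by
    rintro M N ⟨C, hC⟩ ⟨D, hD⟩
    refine ⟨C + D, ?_⟩
    rintro p ⟨y, hy, hy'⟩
    have h1 := hC _ hy
    have h2 := hD _ hy'
    constructor
    · calc p.1 ≤ y + C := h1.1
        _ ≤ (p.2 + D) + C := by gcongr; exact h2.1
        _ = p.2 + (C + D) := by ring
    · calc p.2 ≤ y + D := h2.2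
        _ ≤ (p.1 + C) + D := by gcongr; exact h1.2
        _ = p.1 + (C + D) := by ring
  diag := ⟨0, fun p hp => by
    have : p.1 = p.2 := hp
    simp [this]⟩
  connected x y := by
    refine ⟨{(x, y)}, ⟨x + y, ?_⟩, rfl⟩
    rintro _ rfl
    exact ⟨le_add_left le_self_add, le_add_left le_add_self⟩

theorem metricRay_controlled_of_le {M : Set (ℝ≥0 × ℝ≥0)} {n : ℝ≥0}
    (h : ∀ p ∈ M, p.1 ≤ n ∧ p.2 ≤ n) : metricRay.Controlled M :=
  ⟨n, fun p hp => ⟨(h p hp).1.trans le_add_self, (h p hp).2.trans le_add_self⟩⟩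

theorem exists_le_of_metricRay_bounded {B : Set ℝ≥0} (h : metricRay.Bounded B) :
    ∃ n, ∀ b ∈ B, b ≤ n := by
  rcases h with rfl | ⟨x, C, hC⟩
  · exact ⟨0, by simp⟩
  · exact ⟨x + C, fun b hb => (hC (b, x) ⟨hb, rfl⟩).1⟩

/-- The largest coarse structure on `[0,∞)` that is compatible with the topology: the one with a
single point at infinity. -/
def properRay : CoarseStructure ℝ≥0 where
  Controlled M := ∀ n, ∃ m, ∀ p ∈ M, (p.1 ≤ n → p.2 ≤ m) ∧ (p.2 ≤ n → p.1 ≤ m)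
  union := by
    intro M N hM hN n
    obtain ⟨a, ha⟩ := hM n
    obtain ⟨b, hb⟩ := hN n
    refine ⟨max a b, ?_⟩
    rintro p (hp | hp)
    · exact ⟨fun h => le_max_of_le_left ((ha p hp).1 h),
        fun h => le_max_of_le_left ((ha p hp).2 h)⟩
    · exact ⟨fun h => le_max_of_le_right ((hb p hp).1 h),
        fun h => le_max_of_le_right ((hb p hp).2 h)⟩
  subset := by
    intro M N hN h n
    obtain ⟨a, ha⟩ := hN n
    exact ⟨a, fun p hp => ha p (h hp)⟩
  symm := by
    intro M hM n
    obtain ⟨a, ha⟩ := hM n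
    exact ⟨a, fun p hp => (ha _ hp).symm⟩
  comp := by
    intro M N hM hN n
    obtain ⟨a, ha⟩ := hM n
    obtain ⟨b, hb⟩ := hN n
    obtain ⟨a', ha'⟩ := hN a
    obtain ⟨b', hb'⟩ := hM b
    refine ⟨max a' b', ?_⟩
    rintro p ⟨y, hy, hy'⟩
    exact ⟨fun h => le_max_of_le_left ((ha' _ hy').1 ((ha _ hy).1 h)),
      fun h => le_max_of_le_right ((hb' _ hy).2 ((hb _ hy').2 h))⟩
  diag n := ⟨n, fun p hp => by
    have : p.1 = p.2 := hp
    simp [this]⟩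
  connected x y := by
    refine ⟨{(x, y)}, fun n => ⟨max x y, ?_⟩, rfl⟩
    rintro _ rfl
    exact ⟨fun _ => le_max_right _ _, fun _ => le_max_left _ _⟩

theorem properRay_controlled_of_le {M : Set (ℝ≥0 × ℝ≥0)} {n : ℝ≥0}
    (h : ∀ p ∈ M, p.1 ≤ n ∧ p.2 ≤ n) : properRay.Controlled M :=
  fun _ => ⟨n, fun p hp => ⟨fun _ => (h p hp).2, fun _ => (h p hp).1⟩⟩

theorem exists_le_of_properRay_bounded {B : Set ℝ≥0} (h : properRay.Bounded B) :
    ∃ n, ∀ b ∈ B, b ≤ n := by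
  rcases h with rfl | ⟨x, hx⟩
  · exact ⟨0, by simp⟩
  · obtain ⟨m, hm⟩ := hx x
    exact ⟨m, fun b hb => (hm (b, x) ⟨hb, rfl⟩).2 le_rfl⟩

/-- The union of the unit boxes around the points of a subset of the quadrant. -/
theorem isOpen_boxes (M : Set (ℝ≥0 × ℝ≥0)) :
    IsOpen {q : ℝ≥0 × ℝ≥0 | ∃ p ∈ M, dist q.1 p.1 < 1 ∧ dist q.2 p.2 < 1} := by
  have : {q : ℝ≥0 × ℝ≥0 | ∃ p ∈ M, dist q.1 p.1 < 1 ∧ dist q.2 p.2 < 1} =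
      ⋃ p ∈ M, Metric.ball p.1 1 ×ˢ Metric.ball p.2 1 := by
    ext q
    simp only [mem_ofPred_eq, mem_iUnion₂, mem_prod, Metric.mem_ball, exists_prop]
  rw [this]
  exact isOpen_biUnion fun p _ => Metric.isOpen_ball.prod Metric.isOpen_ball

theorem le_add_one_of_dist {a b : ℝ≥0} (h : dist a b < 1) : a ≤ b + 1 ∧ b ≤ a + 1 := by
  rw [NNReal.dist_eq, abs_lt] at h
  constructor
  · rw [← NNReal.coe_le_coe]; push_cast; linarith
  · rw [← NNReal.coe_le_coe]; push_cast; linarith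

theorem isCompact_closure_of_le {B : Set ℝ≥0} {n : ℝ≥0} (h : ∀ b ∈ B, b ≤ n) :
    IsCompact (closure B) :=
  (isCompact_Icc (a := (0 : ℝ≥0)) (b := n)).of_isClosed_subset isClosed_closure
    (closure_minimal (fun b hb => ⟨zero_le, h b hb⟩) isClosed_Icc)

end CoarseStructure

open CoarseStructure

theorem isGeneralisedRay_metricRay : CoarseSpace.IsGeneralisedRay metricRay where
  compatible := by
    refine ⟨?_, fun B hB => ?_⟩
    · rintro M ⟨C, hC⟩
      -- Each of the two coordinates moves by less than `1` inside a unit box.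
      refine ⟨_, ⟨C + 2, ?_⟩, isOpen_boxes M, fun p hp => ⟨p, hp, by simp⟩⟩
      rintro q ⟨p, hp, h1, h2⟩
      have h1 := le_add_one_of_dist h1
      have h2 := le_add_one_of_dist h2
      have h := hC p hp
      constructor
      · calc q.1 ≤ p.1 + 1 := h1.1
          _ ≤ (p.2 + C) + 1 := by gcongr; exact h.1
          _ ≤ ((q.2 + 1) + C) + 1 := by gcongr; exact h2.2
          _ = q.2 + (C + 2) := by ring
      · calc q.2 ≤ p.2 + 1 := h2.1
          _ ≤ (p.1 + C) + 1 := by gcongr; exact h.2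
          _ ≤ ((q.1 + 1) + C) + 1 := by gcongr; exact h1.2
          _ = q.1 + (C + 2) := by ring
    · obtain ⟨n, hn⟩ := exists_le_of_metricRay_bounded hB
      exact isCompact_closure_of_le hn
  add := by
    rintro M N ⟨C, hC⟩ ⟨D, hD⟩
    refine ⟨C + D, ?_⟩
    rintro _ ⟨m, hm, n, hn, rfl⟩
    constructor
    · calc m.1 + n.1 ≤ (m.2 + C) + (n.2 + D) := add_le_add (hC m hm).1 (hD n hn).1
        _ = m.2 + n.2 + (C + D) := by ring
    · calc m.2 + n.2 ≤ (m.1 + C) + (n.1 + D) := add_le_add (hC m hm).2 (hD n hn).2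
        _ = m.1 + n.1 + (C + D) := by ring
  between := by
    rintro M ⟨C, hC⟩
    refine ⟨C, ?_⟩
    rintro q ⟨m, hm, h1, h2, h3, h4⟩
    exact ⟨h2.trans ((hC m hm).2.trans (by gcongr)), h4.trans ((hC m hm).2.trans (by gcongr))⟩
  translate := by
    rintro M ⟨C, hC⟩ a
    refine ⟨C, ?_⟩
    rintro _ ⟨m, hm, rfl⟩
    constructor
    · change a + m.1 ≤ a + m.2 + C
      rw [add_assoc]; gcongr; exact (hC m hm).1
    · change a + m.2 ≤ a + m.1 + C
      rw [add_assoc]; gcongr; exact (hC m hm).2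

theorem isGeneralisedRay_properRay : CoarseSpace.IsGeneralisedRay properRay where
  compatible := by
    refine ⟨fun M hM => ?_, fun B hB => ?_⟩
    · refine ⟨_, fun n => ?_, isOpen_boxes M, fun p hp => ⟨p, hp, by simp⟩⟩
      -- A point of a unit box with a coordinate at most `n` has a centre with that coordinate at
      -- most `n + 1`.
      obtain ⟨m, hm⟩ := hM (n + 1)
      refine ⟨m + 1, ?_⟩
      rintro q ⟨p, hp, h1, h2⟩
      have h1 := le_add_one_of_dist h1
      have h2 := le_add_one_of_dist h2
      refine ⟨fun h => h2.1.trans ?_, fun h => h1.1.trans ?_⟩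
      · gcongr; exact (hm p hp).1 (h1.2.trans (by gcongr))
      · gcongr; exact (hm p hp).2 (h2.2.trans (by gcongr))
    · obtain ⟨n, hn⟩ := exists_le_of_properRay_bounded hB
      exact isCompact_closure_of_le hn
  add := by
    intro M N hM hN n
    obtain ⟨a, ha⟩ := hM n
    obtain ⟨b, hb⟩ := hN n
    refine ⟨a + b, ?_⟩
    rintro _ ⟨m, hm, n', hn, rfl⟩
    exact ⟨fun h => add_le_add ((ha m hm).1 (le_self_add.trans h))
        ((hb n' hn).1 (le_add_self.trans h)),
      fun h => add_le_add ((ha m hm).2 (le_self_add.trans h))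
        ((hb n' hn).2 (le_add_self.trans h))⟩
  between := by
    intro M hM n
    obtain ⟨a, ha⟩ := hM n
    refine ⟨a, ?_⟩
    rintro q ⟨m, hm, h1, h2, h3, h4⟩
    exact ⟨fun h => h4.trans ((ha m hm).1 (h1.trans h)),
      fun h => h2.trans ((ha m hm).1 (h3.trans h))⟩
  translate := by
    intro M hM a n
    obtain ⟨b, hb⟩ := hM n
    refine ⟨a + b, ?_⟩
    rintro _ ⟨m, hm, rfl⟩
    exact ⟨fun h => add_le_add_right ((hb m hm).1 (le_add_self.trans h)) a,
      fun h => add_le_add_right ((hb m hm).2 (le_add_self.trans h)) a⟩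

/-! ### Points and levels of the cone. -/

namespace Cone

variable {X : Type u}

variable (X) in
/-- The apex of the cone. -/
def apex : Cone X := Quot.mk _ (Sum.inl PUnit.unit)

theorem mk_zero (x : X) : mk x 0 = apex X := Quot.sound (ConeRel.apex x)

theorem map_mk [TopologicalSpace X] {Y : Type u} [TopologicalSpace Y] (f : C(X, Y))
    (x : X) (t : I) : map f (mk x t) = mk (f x) t := rfl

theorem eq_apex_or_mk (c : Cone X) : c = apex X ∨ ∃ x t, 0 < t ∧ c = mk x t := by
  induction c using Quot.ind with | mk p => ?_
  rcases p with _ | ⟨x, t⟩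
  · exact Or.inl rfl
  · rcases eq_or_ne t 0 with rfl | ht
    · exact Or.inl (mk_zero x)
    · exact Or.inr ⟨x, t, unitInterval.pos_iff_ne_zero.2 ht, rfl⟩

theorem exists_eq_mk_of_height_ne {c : Cone X} (h : c.height ≠ 0) : ∃ x, c = mk x c.height := by
  rcases eq_apex_or_mk c with rfl | ⟨x, t, ht, rfl⟩
  · exact absurd rfl h
  · exact ⟨x, rfl⟩

theorem continuous_mk [TopologicalSpace X] : Continuous fun p : X × I => mk p.1 p.2 :=
  continuous_quot_mk.comp continuous_inr

theorem mk_injective {x y : X} {s t : I} (h : mk x s = mk y t) (hs : 0 < s) : x = y := by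
  have : mk y t ∈ Cone.over {x} := by rw [← h]; exact ⟨rfl, hs⟩
  exact this.1.symm

end Cone

namespace OpenCone

variable {X : Type u}

theorem height_lt_one (c : OpenCone X) : (c.1.height : ℝ) < 1 := c.2

/-- The radial coordinate of the open cone, rescaled to `[0,∞)`. -/
noncomputable def level (c : OpenCone X) : ℝ≥0 :=
  ⟨(1 - (c.1.height : ℝ))⁻¹ - 1, by
    have h1 := c.height_lt_one
    have h0 := c.1.height.2.1
    rw [sub_nonneg]
    exact (one_le_inv₀ (by linarith)).2 (by linarith)⟩

theorem coe_level (c : OpenCone X) : (level c : ℝ) = (1 - (c.1.height : ℝ))⁻¹ - 1 := rfl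

theorem level_congr {Y : Type v} {c : OpenCone X} {d : OpenCone Y}
    (h : c.1.height = d.1.height) : level c = level d :=
  NNReal.eq (congrArg (fun h : I => (1 - (h : ℝ))⁻¹ - 1) h)

theorem level_eq_zero {c : OpenCone X} (h : c.1.height = 0) : level c = 0 := by
  apply NNReal.eq
  rw [coe_level, h]
  simp

/-- The height of the points of a given level. -/
noncomputable def heightOfLevel (r : ℝ≥0) : I :=
  ⟨1 - (1 + (r : ℝ))⁻¹, by
    have : (0 : ℝ) < 1 + r := by positivity
    constructor
    · rw [sub_nonneg]
      exact inv_le_one_of_one_le₀ (by linarith [r.2])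
    · linarith [inv_pos.2 this]⟩

theorem heightOfLevel_lt_one (r : ℝ≥0) : heightOfLevel r < 1 := by
  have : (0 : ℝ) < 1 + r := by positivity
  change (1 - (1 + (r : ℝ))⁻¹ : ℝ) < 1
  linarith [inv_pos.2 this]

theorem level_of_height {c : OpenCone X} {r : ℝ≥0} (h : c.1.height = heightOfLevel r) :
    level c = r := by
  apply NNReal.eq
  rw [coe_level, h]
  change (1 - (1 - (1 + (r : ℝ))⁻¹))⁻¹ - 1 = r
  rw [sub_sub_cancel, inv_inv]
  ring

section Limits

open Filter

variable [TopologicalSpace X] {α : Type w} {F : Filter α} {c : α → OpenCone X} {a : Cone X}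

theorem tendsto_level_atTop (h : Tendsto (fun i => (c i).1) F (𝓝 a)) (ha : a.height = 1) :
    Tendsto (fun i => level (c i)) F atTop := by
  rw [← NNReal.tendsto_coe_atTop]
  have h1 : Tendsto (fun i => ((c i).1.height : ℝ)) F (𝓝 1) := by
    have := ((continuous_subtype_val.comp Cone.continuous_height).tendsto a).comp h
    simpa [Function.comp_def, ha] using this
  have h2 : Tendsto (fun i => 1 - ((c i).1.height : ℝ)) F (𝓝[>] 0) := by
    refine tendsto_nhdsWithin_iff.2 ⟨by simpa using h1.const_sub 1, .of_forall fun i => ?_⟩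
    exact sub_pos.2 (c i).height_lt_one
  exact tendsto_atTop_add_const_right _ (-1) (tendsto_inv_nhdsGT_zero.comp h2)

theorem height_eq_one_of_tendsto [F.NeBot] (h : Tendsto (fun i => (c i).1) F (𝓝 a))
    (hl : Tendsto (fun i => level (c i)) F atTop) : a.height = 1 := by
  have h1 : Tendsto (fun i => ((c i).1.height : ℝ)) F (𝓝 (a.height : ℝ)) :=
    ((continuous_subtype_val.comp Cone.continuous_height).tendsto a).comp h
  have h2 : Tendsto (fun i => 1 - ((level (c i) : ℝ) + 1)⁻¹) F (𝓝 (1 - 0)) :=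
    (tendsto_inv_atTop_zero.comp (tendsto_atTop_add_const_right _ 1
      (NNReal.tendsto_coe_atTop.2 hl))).const_sub 1
  have h3 : (fun i => 1 - ((level (c i) : ℝ) + 1)⁻¹) = fun i => ((c i).1.height : ℝ) := by
    funext i
    rw [coe_level, sub_add_cancel, inv_inv, sub_sub_cancel]
  rw [h3, sub_zero] at h2
  exact Subtype.ext (tendsto_nhds_unique h1 h2)

theorem height_ne_one_of_level_le [F.NeBot] {n : ℝ≥0}
    (h : Tendsto (fun i => (c i).1) F (𝓝 a)) (hn : ∀ᶠ i in F, level (c i) ≤ n) :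
    a.height ≠ 1 := fun ha => by
  obtain ⟨i, h1, h2⟩ := (hn.and ((tendsto_level_atTop h ha).eventually_gt_atTop n)).exists
  exact absurd h1 h2.not_ge

end Limits

end OpenCone

/-! ### Continuous control in terms of limits and levels. -/

namespace continuouslyControlled

open Filter OpenCone

variable {X : Type u} [TopologicalSpace X] [CompactSpace X] [T2Space X]

/-- Points of the closure are limits along ultrafilters. Indexing the pairs by an arbitrary `S : Set
α` allows auxiliary points, such as base points in `X` or witnesses of other relations, to be
carried along in the index. -/
theorem controlled_image {α : Type w} {S : Set α} {c d : α → OpenCone X}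
    (h : ∀ F : Ultrafilter α, S ∈ F → ∀ a b, Tendsto (fun i => (c i).1) F (𝓝 a) →
      Tendsto (fun i => (d i).1) F (𝓝 b) → a.height = 1 ∨ b.height = 1 → a = b) :
    (continuouslyControlled X).Controlled ((fun i => (c i, d i)) '' S) := by
  intro p hp hb
  rw [OpenCone.lift, image_image] at hp
  obtain ⟨F, hS, hF⟩ := exists_ultrafilter_tendsto_of_mem_closure_image hp
  exact h F hS p.1 p.2 ((continuous_fst.tendsto p).comp hF) ((continuous_snd.tendsto p).comp hF) hb

theorem eq_of_tendsto {M : Set (OpenCone X × OpenCone X)}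
    (hM : (continuouslyControlled X).Controlled M) {α : Type w} {F : Filter α} [F.NeBot]
    {c d : α → OpenCone X} (h : ∀ᶠ i in F, (c i, d i) ∈ M) {a b : Cone X}
    (ha : Tendsto (fun i => (c i).1) F (𝓝 a)) (hb : Tendsto (fun i => (d i).1) F (𝓝 b))
    (hab : a.height = 1 ∨ b.height = 1) : a = b :=
  hM (a, b) (mem_closure_of_tendsto (ha.prodMk_nhds hb) (h.mono fun _ hi => ⟨_, hi, rfl⟩)) hab

/-- Along an ultrafilter both components converge in the compact closed cone. If one limit is at
infinity, control forces the two limits to coincide. -/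
theorem tendsto_level_iff {M : Set (OpenCone X × OpenCone X)}
    (hM : (continuouslyControlled X).Controlled M) {α : Type w} {F : Ultrafilter α}
    {c d : α → OpenCone X} (h : ∀ᶠ i in (F : Filter α), (c i, d i) ∈ M) :
    Tendsto (fun i => level (c i)) F atTop ↔ Tendsto (fun i => level (d i)) F atTop := by
  obtain ⟨a, ha⟩ := F.exists_tendsto_of_compactSpace fun i => (c i).1
  obtain ⟨b, hb⟩ := F.exists_tendsto_of_compactSpace fun i => (d i).1
  constructor
  · intro hc
    have h1 := height_eq_one_of_tendsto ha hc
    have e := eq_of_tendsto hM h ha hb (Or.inl h1)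
    exact tendsto_level_atTop hb (e ▸ h1)
  · intro hd
    have h1 := height_eq_one_of_tendsto hb hd
    have e := eq_of_tendsto hM h ha hb (Or.inr h1)
    exact tendsto_level_atTop ha (e ▸ h1)

theorem exists_level_le {M : Set (OpenCone X × OpenCone X)}
    (hM : (continuouslyControlled X).Controlled M) (n : ℝ≥0) :
    ∃ m, ∀ p ∈ M, level p.1 ≤ n → level p.2 ≤ m := by
  by_contra! H
  choose p hpM hp1 hp2 using fun k : ℕ => H k
  -- The counterexamples form a sequence whose second component escapes to infinity while the first
  -- stays below level `n`; a nonprincipal ultrafilter on `ℕ` supplies the limits.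
  have h2 : Tendsto (fun k => level (p k).2) (hyperfilter ℕ : Filter ℕ) atTop :=
    (tendsto_atTop_mono (fun k => (hp2 k).le) tendsto_natCast_atTop_atTop).mono_left
      Nat.hyperfilter_le_atTop
  have h1 := (tendsto_level_iff hM (c := fun k => (p k).1) (d := fun k => (p k).2)
    (.of_forall hpM)).2 h2
  obtain ⟨k, hk⟩ := (h1.eventually_gt_atTop n).exists
  exact absurd (hp1 k) hk.not_ge

theorem bounded_level_le (n : ℝ≥0) :
    (continuouslyControlled X).Bounded {c | level c ≤ n} := by
  apply bounded_of_prod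
  have := controlled_image (X := X) (S := {c : OpenCone X | level c ≤ n} ×ˢ {c | level c ≤ n})
    (c := Prod.fst) (d := Prod.snd) (by
      intro F hS a b ha hb hab
      exfalso
      rcases hab with h | h
      · exact height_ne_one_of_level_le ha (mem_of_superset hS fun p hp => hp.1) h
      · exact height_ne_one_of_level_le hb (mem_of_superset hS fun p hp => hp.2) h)
  simpa using this

theorem exists_level_le_of_bounded {B : Set (OpenCone X)}
    (hB : (continuouslyControlled X).Bounded B) : ∃ n, ∀ c ∈ B, level c ≤ n := by
  rcases hB with rfl | ⟨x, hx⟩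
  · exact ⟨0, by simp⟩
  · obtain ⟨m, hm⟩ := exists_level_le ((continuouslyControlled X).symm hx) (level x)
    exact ⟨m, fun c hc => hm (x, c) ⟨hc, rfl⟩ le_rfl⟩

/-- The target is `properRay` because controlled sets bound levels only in terms of one another; in
general they do not bound the difference of levels, as `metricRay` would require. -/
theorem isCoarseMap_level : IsCoarseMap (continuouslyControlled X) properRay level where
  controlled M hM n := by
    obtain ⟨a, ha⟩ := exists_level_le hM n
    obtain ⟨b, hb⟩ := exists_level_le ((continuouslyControlled X).symm hM) n
    refine ⟨max a b, ?_⟩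
    rintro _ ⟨p, hp, rfl⟩
    exact ⟨fun h => le_max_of_le_left (ha p hp h),
      fun h => le_max_of_le_right (hb p.swap hp h)⟩
  proper B hB := by
    obtain ⟨n, hn⟩ := exists_le_of_properRay_bounded hB
    exact (bounded_level_le n).mono fun c hc => hn _ hc

end continuouslyControlled

theorem level_openConeMap {X Y : CompHaus.{u}} (f : X ⟶ Y) (c : OpenCone X) :
    OpenCone.level ((openConeMap f).toFun c : OpenCone Y) = c.level :=
  OpenCone.level_congr (Cone.height_map _ _)

namespace CoarseStructure

theorem bounded_iff_prod {X : Type u} {s : CoarseStructure X} {B : Set X} :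
    s.Bounded B ↔ s.Controlled (B ×ˢ B) :=
  ⟨fun h => h.prod h, bounded_of_prod⟩

theorem prod_controlled_iff {X : Type u} {Y : Type v} {s : CoarseStructure X}
    {t : CoarseStructure Y} {M : Set ((X × Y) × (X × Y))} :
    (s.prod t).Controlled M ↔ s.Controlled ((fun p => (p.1.1, p.2.1)) '' M) ∧
      t.Controlled ((fun p => (p.1.2, p.2.2)) '' M) := by
  constructor
  · rintro ⟨M₁, M₂, h₁, h₂, h⟩
    refine ⟨s.subset h₁ ?_, t.subset h₂ ?_⟩
    · rintro _ ⟨p, hp, rfl⟩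
      exact (h p hp).1
    · rintro _ ⟨p, hp, rfl⟩
      exact (h p hp).2
  · rintro ⟨h₁, h₂⟩
    exact ⟨_, _, h₁, h₂, fun p hp => ⟨⟨p, hp, rfl⟩, ⟨p, hp, rfl⟩⟩⟩

theorem prod_bounded_iff {X : Type u} {Y : Type v} {s : CoarseStructure X}
    {t : CoarseStructure Y} {B : Set (X × Y)} :
    (s.prod t).Bounded B ↔ s.Bounded (Prod.fst '' B) ∧ t.Bounded (Prod.snd '' B) := by
  rw [bounded_iff_prod, bounded_iff_prod, bounded_iff_prod, prod_controlled_iff]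
  have h1 : (fun p : (X × Y) × (X × Y) => (p.1.1, p.2.1)) '' (B ×ˢ B) =
      (Prod.fst '' B) ×ˢ (Prod.fst '' B) := (prod_image_image_eq).symm
  have h2 : (fun p : (X × Y) × (X × Y) => (p.1.2, p.2.2)) '' (B ×ˢ B) =
      (Prod.snd '' B) ×ˢ (Prod.snd '' B) := (prod_image_image_eq).symm
  rw [h1, h2]

theorem sub_bounded_iff {X : Type u} {s : CoarseStructure X} {A : Set X} {B : Set A} :
    (s.sub A).Bounded B ↔ s.Bounded (Subtype.val '' B) := by
  rw [bounded_iff_prod, bounded_iff_prod, ← prodMap_image_prod]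
  rfl

theorem metricRay_bounded_iff {B : Set ℝ≥0} :
    metricRay.Bounded B ↔ ∃ n, ∀ b ∈ B, b ≤ n :=
  ⟨exists_le_of_metricRay_bounded, fun ⟨_, hn⟩ => bounded_of_prod
    (metricRay_controlled_of_le fun p hp => ⟨hn p.1 hp.1, hn p.2 hp.2⟩)⟩

end CoarseStructure

open Filter in
theorem Cone.eq_mk_of_tendsto {X : Type u} [TopologicalSpace X] [T2Space X] {α : Type w}
    {F : Filter α} [F.NeBot] {e : α → Cone X} {z : α → X} {x : X} {y : Cone X}
    (he : ∀ᶠ i in F, e i = Cone.mk (z i) (e i).height) (hz : Tendsto z F (𝓝 x))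
    (hy : Tendsto e F (𝓝 y)) : y = Cone.mk x y.height := by
  have h1 : Tendsto (fun i => (e i).height) F (𝓝 y.height) :=
    (Cone.continuous_height.tendsto y).comp hy
  have h2 := (Cone.continuous_mk.tendsto (x, y.height)).comp (hz.prodMk_nhds h1)
  exact tendsto_nhds_unique (hy.congr' he) h2

namespace continuouslyControlled

open Filter OpenCone

variable {X : Type u} [TopologicalSpace X] [CompactSpace X] [T2Space X]

theorem bounded_iff {B : Set (OpenCone X)} :
    (continuouslyControlled X).Bounded B ↔ ∃ n, ∀ c ∈ B, level c ≤ n :=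
  ⟨exists_level_le_of_bounded, fun ⟨n, hn⟩ => (bounded_level_le n).mono hn⟩

/-- A family of pairs of points on common rays is controlled if the two points of a pair leave
all bounded sets simultaneously. -/
theorem controlled_of_base {α : Type w} {S : Set α} {c d : α → OpenCone X} (z : α → X)
    (hc : ∀ i ∈ S, (c i).1 = Cone.mk (z i) (c i).1.height)
    (hd : ∀ i ∈ S, (d i).1 = Cone.mk (z i) (d i).1.height)
    (h : ∀ F : Ultrafilter α, S ∈ F → (Tendsto (fun i => level (c i)) F atTop ↔
      Tendsto (fun i => level (d i)) F atTop)) :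
    (continuouslyControlled X).Controlled ((fun i => (c i, d i)) '' S) := by
  refine controlled_image fun F hS a b ha hb hab => ?_
  -- By compactness of `X` the common base points converge, so both limits lie on the ray over `x`
  -- and are determined by their heights.
  obtain ⟨x, hx⟩ := F.exists_tendsto_of_compactSpace z
  have ea := Cone.eq_mk_of_tendsto (mem_of_superset hS hc) hx ha
  have eb := Cone.eq_mk_of_tendsto (mem_of_superset hS hd) hx hb
  have h1 : a.height = 1 ∧ b.height = 1 := by
    rcases hab with hab | hab
    · exact ⟨hab, height_eq_one_of_tendsto hb ((h F hS).1 (tendsto_level_atTop ha hab))⟩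
    · exact ⟨height_eq_one_of_tendsto ha ((h F hS).2 (tendsto_level_atTop hb hab)), hab⟩
  rw [ea, eb, h1.1, h1.2]

end continuouslyControlled

/-! ### The graph of the level function in a flasque space. -/

open OpenCone

/-- The product of the open cone with the metric ray. -/
abbrev coneProd (X : CompHaus.{u}) : CoarseSpace.{u} :=
  ⟨OpenCone X × ℝ≥0, (continuouslyControlled X).prod metricRay⟩

theorem flasque_coneProd (X : CompHaus.{u}) : (coneProd X).Flasque := by
  let t : OpenCone X × ℝ≥0 → OpenCone X × ℝ≥0 := fun q => (q.1, q.2 + 1)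
  have ht : ∀ n : ℕ, ∀ q, t^[n] q = (q.1, q.2 + n) := by
    intro n q
    induction n with
    | zero => simp
    | succ n ih =>
      rw [Function.iterate_succ_apply', ih]
      simp [t, add_assoc]
  have ht₁ : ∀ n (q : OpenCone X × ℝ≥0), (t^[n] q).1 = q.1 := fun n q => by rw [ht]
  have ht₂ : ∀ n (q : OpenCone X × ℝ≥0), (t^[n] q).2 = q.2 + n := fun n q => by rw [ht]
  refine ⟨t, fun B hB => ?_, fun M hM => ?_, ?_⟩
  · obtain ⟨n, hn⟩ := metricRay_bounded_iff.1 (prod_bounded_iff.1 hB).2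
    obtain ⟨N, hN⟩ := exists_nat_gt n
    refine ⟨N, fun k hk => eq_empty_of_forall_notMem ?_⟩
    rintro _ ⟨⟨q, rfl⟩, hq⟩
    have h1 : q.2 + k ≤ n := (ht₂ k q).symm.trans_le (hn _ ⟨_, hq, rfl⟩)
    have h2 : (N : ℝ≥0) ≤ k := by exact_mod_cast hk
    exact absurd ((h2.trans le_add_self).trans h1) hN.not_ge
  · obtain ⟨h1, C, hC⟩ := prod_controlled_iff.1 hM
    refine prod_controlled_iff.2 ⟨(continuouslyControlled X).subset h1 ?_, C, ?_⟩
    · rintro _ ⟨_, hp', rfl⟩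
      obtain ⟨n, p, hp, rfl⟩ := mem_iUnion.1 hp'
      exact ⟨p, hp, Prod.ext (ht₁ n p.1).symm (ht₁ n p.2).symm⟩
    · rintro _ ⟨_, hp', rfl⟩
      obtain ⟨n, p, hp, rfl⟩ := mem_iUnion.1 hp'
      have h : p.1.2 ≤ p.2.2 + C ∧ p.2.2 ≤ p.1.2 + C := hC _ ⟨p, hp, rfl⟩
      change (t^[n] p.1).2 ≤ (t^[n] p.2).2 + C ∧ (t^[n] p.2).2 ≤ (t^[n] p.1).2 + C
      rw [ht₂, ht₂, add_right_comm _ (n : ℝ≥0) C, add_right_comm _ (n : ℝ≥0) C]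
      exact ⟨add_le_add_left h.1 _, add_le_add_left h.2 _⟩
  · refine prod_controlled_iff.2 ⟨(continuouslyControlled X).subset
      (continuouslyControlled X).diag ?_, 1, ?_⟩
    · rintro _ ⟨_, ⟨q, rfl⟩, rfl⟩
      rfl
    · rintro _ ⟨_, ⟨q, rfl⟩, rfl⟩
      exact ⟨le_rfl, le_self_add.trans le_self_add⟩

/-- The part of `𝒪X × [0,∞)` below the graph of the level function. -/
def belowGraph (X : CompHaus.{u}) : Set (coneProd X).carrier := {q | q.2 ≤ level q.1}

/-- The part of `𝒪X × [0,∞)` above the graph of the level function. -/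
def aboveGraph (X : CompHaus.{u}) : Set (coneProd X).carrier := {q | level q.1 ≤ q.2}

-- A point `(c, r)` near both parts is compared with the graph point `(d, r)`, where `d` lies on the
-- ray of `c` at level `r`. Closeness to a point below and to a point above the graph makes `r` and
-- the level of `c` tend to infinity simultaneously. By `controlled_of_base` this is all that is
-- needed.
open Filter continuouslyControlled in
theorem coarselyExcisiveDecomposition_graph (X : CompHaus.{u}) :
    (coneProd X).CoarselyExcisiveDecomposition (belowGraph X) (aboveGraph X) := by
  refine ⟨eq_univ_of_forall fun q => le_total q.2 (level q.1), fun m hm => ?_⟩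
  obtain ⟨M₁, M₂, hM₁, ⟨C, hC⟩, hm⟩ := hm
  -- At the apex no ray is singled out, so `(c, 0)` is used there instead. The constant `K` bounds
  -- the level of a point related to one of level `0`, hence bounds `r` by `K + C`.
  obtain ⟨K, hK⟩ := exists_level_le ((continuouslyControlled X).symm hM₁) 0
  -- The entries are the base point `z`, the graph point `(d, r)`, the given point `(c, r)`, and the
  -- cone coordinates of the witnesses below and above the graph. The witnesses are kept so that
  -- their levels can be followed along an ultrafilter.
  let T : Set (X × (OpenCone X × ℝ≥0) × (OpenCone X × ℝ≥0) × OpenCone X × OpenCone X) :=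
    {x | x.2.1.1.1 = Cone.mk x.1 x.2.1.1.1.height ∧ x.2.2.1.1.1 = Cone.mk x.1 x.2.2.1.1.1.height ∧
      level x.2.1.1 = x.2.1.2 ∧ x.2.1.2 = x.2.2.1.2 ∧
      (x.2.2.2.1, x.2.2.1.1) ∈ M₁ ∧ x.2.2.1.2 ≤ level x.2.2.2.1 + C ∧
      (x.2.2.2.2, x.2.2.1.1) ∈ M₁ ∧ level x.2.2.2.2 ≤ x.2.2.1.2 + C}
  let S : Set ((OpenCone X × ℝ≥0) × (OpenCone X × ℝ≥0)) :=
    {p | level p.1.1 ≤ 0 ∧ level p.2.1 ≤ 0 ∧ p.1.2 ≤ K + C ∧ p.2.2 ≤ K + C}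
  refine ⟨S ∪ (fun x => (x.2.1, x.2.2.1)) '' T, (coneProd X).str.union ?_ ?_, ?_⟩
  · refine prod_controlled_iff.2 ⟨(continuouslyControlled X).subset
      ((bounded_level_le 0).prod (bounded_level_le 0)) ?_, metricRay_controlled_of_le
        (n := K + C) ?_⟩
    · rintro _ ⟨p, hp, rfl⟩
      exact ⟨hp.1, hp.2.1⟩
    · rintro _ ⟨p, hp, rfl⟩
      exact hp.2.2
  · refine prod_controlled_iff.2 ?_
    rw [image_image, image_image]
    refine ⟨controlled_of_base (fun x => x.1) (fun x hx => hx.1) (fun x hx => hx.2.1) ?_, 0, ?_⟩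
    · intro F hF
      have h1 := tendsto_level_iff hM₁ (F := F) (c := fun x => x.2.2.2.1) (d := fun x => x.2.2.1.1)
        (mem_of_superset hF fun x hx => hx.2.2.2.2.1)
      have h2 := tendsto_level_iff hM₁ (F := F) (c := fun x => x.2.2.2.2) (d := fun x => x.2.2.1.1)
        (mem_of_superset hF fun x hx => hx.2.2.2.2.2.2.1)
      constructor
      · intro h
        refine h1.1 ?_
        have h3 : Tendsto
            (fun x : X × (OpenCone X × ℝ≥0) × (OpenCone X × ℝ≥0) × OpenCone X × OpenCone X =>
              level x.2.2.2.1 + C) F atTop :=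
          tendsto_atTop_mono' _ (mem_of_superset hF fun x hx =>
            (hx.2.2.1.trans hx.2.2.2.1).trans_le hx.2.2.2.2.2.1) h
        exact h3.atTop_of_add_const C
      · intro h
        have h3 : Tendsto
            (fun x : X × (OpenCone X × ℝ≥0) × (OpenCone X × ℝ≥0) × OpenCone X × OpenCone X =>
              level x.2.1.1 + C) F atTop :=
          tendsto_atTop_mono' _ (mem_of_superset hF fun x hx =>
            hx.2.2.2.2.2.2.2.trans (add_le_add_left (hx.2.2.1.trans hx.2.2.2.1).ge C)) (h2.2 h)
        exact h3.atTop_of_add_const C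
    · rintro _ ⟨x, hx, rfl⟩
      have : x.2.1.2 = x.2.2.1.2 := hx.2.2.2.1
      simp [this]
  · rintro ⟨c, r⟩ ⟨⟨q₁, hq₁, hm₁⟩, ⟨q₂, hq₂, hm₂⟩⟩
    have h1 := hm _ hm₁
    have h2 := hm _ hm₂
    have hr1 : r ≤ level q₁.1 + C := ((hC _ h1.2).2).trans (by gcongr; exact hq₁)
    have hr2 : level q₂.1 ≤ r + C := le_trans hq₂ (hC _ h2.2).1
    by_cases hc : c.1.height = 0
    · have hl := level_eq_zero hc
      refine ⟨(c, 0), ⟨bot_le (a := level c), hl.le⟩, Or.inl ⟨hl.le, hl.le, bot_le, ?_⟩⟩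
      exact hr1.trans (by gcongr; exact hK (c, q₁.1) h1.1 hl.le)
    · obtain ⟨z, hz⟩ := Cone.exists_eq_mk_of_height_ne hc
      let d : OpenCone X := ⟨Cone.mk z (heightOfLevel r), heightOfLevel_lt_one r⟩
      have hd : level d = r := level_of_height rfl
      exact ⟨(d, r), ⟨hd.ge, hd.le⟩, Or.inr ⟨(z, (d, r), (c, r), q₁.1, q₂.1),
        ⟨rfl, hz, hd, rfl, h1.1, hr1, h2.1, hr2⟩, rfl⟩⟩

/-- The graph of the level function in `𝒪X × [0,∞)`. -/
abbrev coneGraph (X : CompHaus.{u}) : CoarseSpace.{u} :=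
  (coneProd X).sub (belowGraph X ∩ aboveGraph X)

namespace coneGraph

variable {X Y : CompHaus.{u}}

theorem level_eq (q : (coneGraph X).carrier) : level q.1.1 = q.1.2 := le_antisymm q.2.2 q.2.1

theorem controlled_iff {M : Set ((coneGraph X).carrier × (coneGraph X).carrier)} :
    (coneGraph X).str.Controlled M ↔
      (continuouslyControlled X).Controlled ((fun p => (p.1.1.1, p.2.1.1)) '' M) ∧
        ∃ C, ∀ p ∈ M, p.1.1.2 ≤ p.2.1.2 + C ∧ p.2.1.2 ≤ p.1.1.2 + C := by
  refine prod_controlled_iff.trans (and_congr ⟨fun h => ?_, fun h => ?_⟩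
    (exists_congr fun C => ⟨fun h p hp => ?_, fun h => ?_⟩))
  · refine (continuouslyControlled X).subset h ?_
    rintro _ ⟨p, hp, rfl⟩
    exact ⟨_, ⟨p, hp, rfl⟩, rfl⟩
  · refine (continuouslyControlled X).subset h ?_
    rintro _ ⟨_, ⟨p, hp, rfl⟩, rfl⟩
    exact ⟨p, hp, rfl⟩
  · exact h _ ⟨_, ⟨p, hp, rfl⟩, rfl⟩
  · rintro _ ⟨_, ⟨p, hp, rfl⟩, rfl⟩
    exact h p hp

theorem bounded_iff {B : Set (coneGraph X).carrier} :
    (coneGraph X).str.Bounded B ↔ ∃ n, ∀ q ∈ B, q.1.2 ≤ n := by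
  refine sub_bounded_iff.trans (prod_bounded_iff.trans ?_)
  rw [continuouslyControlled.bounded_iff, metricRay_bounded_iff]
  constructor
  · rintro ⟨-, n, hn⟩
    exact ⟨n, fun q hq => hn _ ⟨_, ⟨q, hq, rfl⟩, rfl⟩⟩
  · rintro ⟨n, hn⟩
    refine ⟨⟨n, ?_⟩, n, ?_⟩
    · rintro _ ⟨_, ⟨q, hq, rfl⟩, rfl⟩
      exact (level_eq q).trans_le (hn q hq)
    · rintro _ ⟨_, ⟨q, hq, rfl⟩, rfl⟩
      exact hn q hq

theorem isCoarseMap_snd :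
    IsCoarseMap (coneGraph X).str metricRay fun q => q.1.2 where
  controlled M hM := by
    obtain ⟨-, C, hC⟩ := controlled_iff.1 hM
    exact ⟨C, forall_mem_image.2 hC⟩
  proper B hB := bounded_iff.2 <| by
    obtain ⟨n, hn⟩ := metricRay_bounded_iff.1 hB
    exact ⟨n, fun q hq => hn _ hq⟩

/-- The map of graphs induced by a continuous map. -/
def map (f : X ⟶ Y) : coneGraph X ⟶ coneGraph Y where
  toFun q := ⟨((openConeMap f).toFun q.1.1, q.1.2),
    (level_eq q).ge.trans (level_openConeMap f q.1.1).ge,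
    (level_openConeMap f q.1.1).le.trans (level_eq q).le⟩
  isCoarse :=
    { controlled := fun M hM => by
        obtain ⟨h, C, hC⟩ := controlled_iff.1 hM
        refine controlled_iff.2 ⟨?_, C, forall_mem_image.2 hC⟩
        refine (continuouslyControlled Y).subset ((openConeMap f).isCoarse.controlled _ h) ?_
        rintro _ ⟨_, ⟨p, hp, rfl⟩, rfl⟩
        exact ⟨_, ⟨p, hp, rfl⟩, rfl⟩
      proper := fun B hB => bounded_iff.2 <| by
        obtain ⟨n, hn⟩ := bounded_iff.1 hB
        exact ⟨n, fun q hq => hn _ hq⟩ }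

theorem map_comp {Z : CompHaus.{u}} (f : X ⟶ Y) (g : Y ⟶ Z) : map (f ≫ g) = map f ≫ map g := by
  apply CoarseSpace.Hom.ext
  funext q
  apply Subtype.ext
  exact Prod.ext (congrArg (fun φ : openCone X ⟶ openCone Z => φ.toFun q.1.1)
    (openConeFunctor.map_comp f g)) rfl

theorem map_id : map (𝟙 X) = 𝟙 (coneGraph X) := by
  apply CoarseSpace.Hom.ext
  funext q
  apply Subtype.ext
  exact Prod.ext (congrArg (fun φ : openCone X ⟶ openCone X => φ.toFun q.1.1)
    (openConeFunctor.map_id X)) rfl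

end coneGraph

/-! ### Homotopies on the graph. -/

/-- The product of the quotient map onto the cone with `I` is again a quotient map, `I` being
locally compact; so continuity may be checked before collapsing. -/
theorem Cone.continuous_map_family {X Z : Type u} [TopologicalSpace X] [TopologicalSpace Z]
    (G : C(I, C(X, Z))) (hG : Continuous fun p : X × I => G p.2 p.1) :
    Continuous fun p : Cone X × I => Cone.map (G p.2) p.1 := by
  have hq : IsQuotientMap (Quot.mk (ConeRel X)) := isQuotientMap_quot_mk
  refine hq.continuous_lift_prod_left (g := fun p : Cone X × I => Cone.map (G p.2) p.1) ?_
  rw [← Homeomorph.sumProdDistrib.symm.comp_continuous_iff']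
  refine continuous_sum_dom.2 ⟨continuous_const (y := Cone.apex Z), ?_⟩
  have : Continuous fun p : (X × I) × I => (G p.2 p.1.1, p.1.2) :=
    (hG.comp ((continuous_fst.comp continuous_fst).prodMk continuous_snd)).prodMk
      (continuous_snd.comp continuous_fst)
  exact Cone.continuous_mk.comp this

/-- The difference equals `((u - u') + (u' / (r' + 1)) * (r' - r)) / (r + 1)`, and `u' / (r' + 1)`
lies in `[0, 1]`. The bound tends to `0` as `r` grows, which is the reason for rescaling time by the
level. -/
theorem abs_div_sub_div_le {u u' r r' C D : ℝ} (hr : 0 ≤ r) (hu' : 0 ≤ u') (hur : u' ≤ r' + 1)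
    (hD : |u - u'| ≤ D) (hC : |r - r'| ≤ C) (hr' : 0 ≤ r') :
    |u / (r + 1) - u' / (r' + 1)| ≤ (D + C) / (r + 1) := by
  have h0 : 0 < r + 1 := by linarith
  have h0' : 0 < r' + 1 := by linarith
  have e : u / (r + 1) - u' / (r' + 1) =
      ((u - u') + (u' / (r' + 1)) * (r' - r)) / (r + 1) := by
    field_simp
    ring
  have h1 : |u' / (r' + 1)| ≤ 1 := by
    rw [abs_of_nonneg (by positivity)]
    exact (div_le_one h0').2 hur
  rw [e, abs_div, abs_of_pos h0]
  gcongr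
  calc |(u - u') + (u' / (r' + 1)) * (r' - r)|
      ≤ |u - u'| + |u' / (r' + 1)| * |r' - r| := by
        rw [← abs_mul]; exact abs_add_le _ _
    _ ≤ D + 1 * C := by
        rw [abs_sub_comm r' r]
        gcongr
    _ = D + C := by ring

namespace coneGraph

variable {X Y : CompHaus.{u}}

/-- The parameter `u / (r + 1)` in the unit interval. -/
noncomputable def param (u r : ℝ≥0) : I := projIcc 0 1 zero_le_one ((u : ℝ) / (r + 1))

theorem param_zero (r : ℝ≥0) : param 0 r = 0 := by
  simp [param]

theorem param_self (r : ℝ≥0) : param (r + 1) r = 1 := by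
  have : ((r + 1 : ℝ≥0) : ℝ) / (r + 1) = 1 := by
    push_cast
    exact div_self (by positivity)
  rw [param, this]
  simp

theorem dist_param_le {u u' r r' C D : ℝ≥0} (hur : u' ≤ r' + 1) (hD : u ≤ u' + D ∧ u' ≤ u + D)
    (hC : r ≤ r' + C ∧ r' ≤ r + C) :
    dist (param u r) (param u' r') ≤ (D + C) / ((r : ℝ) + 1) := by
  refine (abs_projIcc_sub_projIcc zero_le_one).trans ?_
  simp only [← NNReal.coe_le_coe, NNReal.coe_add, NNReal.coe_one] at hur hD hC
  exact abs_div_sub_div_le r.2 u'.2 hur (abs_le.2 ⟨by linarith, by linarith⟩)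
    (abs_le.2 ⟨by linarith, by linarith⟩) r'.2

-- If a limit lies at infinity, control of the pairs `(c i, d i)` gives them a common limit there.
-- Levels then tend to infinity, so by `dist_param_le` the two time parameters have the same limit,
-- and so do the images under the jointly continuous family.
open Filter in
theorem controlled_map_family {X Z : Type u} [TopologicalSpace X] [CompactSpace X] [T2Space X]
    [TopologicalSpace Z] [CompactSpace Z] [T2Space Z] {G : I → C(X, Z)}
    (hG : Continuous fun p : Cone X × I => Cone.map (G p.2) p.1) {α : Type w} {S : Set α}
    {c d : α → OpenCone X} {u u' : α → ℝ≥0} {h h' : α → OpenCone Z}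
    (hh : ∀ i, (h i).1 = Cone.map (G (param (u i) (level (c i)))) (c i).1)
    (hh' : ∀ i, (h' i).1 = Cone.map (G (param (u' i) (level (d i)))) (d i).1)
    {M : Set (OpenCone X × OpenCone X)} (hM : (continuouslyControlled X).Controlled M)
    (hcd : ∀ i ∈ S, (c i, d i) ∈ M) (hud : ∀ i ∈ S, u' i ≤ level (d i) + 1) {C D : ℝ≥0}
    (hC : ∀ i ∈ S, level (c i) ≤ level (d i) + C ∧ level (d i) ≤ level (c i) + C)
    (hD : ∀ i ∈ S, u i ≤ u' i + D ∧ u' i ≤ u i + D) :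
    (continuouslyControlled Z).Controlled ((fun i => (h i, h' i)) '' S) := by
  refine continuouslyControlled.controlled_image fun F hS a b ha hb hab => ?_
  obtain ⟨a₀, ha₀⟩ := F.exists_tendsto_of_compactSpace fun i => (c i).1
  obtain ⟨b₀, hb₀⟩ := F.exists_tendsto_of_compactSpace fun i => (d i).1
  obtain ⟨s, hs⟩ := F.exists_tendsto_of_compactSpace fun i => param (u i) (level (c i))
  obtain ⟨t, ht⟩ := F.exists_tendsto_of_compactSpace fun i => param (u' i) (level (d i))
  have key : ∀ {e : α → Cone X} {p : α → I} {g : α → OpenCone Z} {y : Cone X} {x : Cone Z} {r : I},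
      Tendsto e F (𝓝 y) → Tendsto p F (𝓝 r) → (∀ i, (g i).1 = Cone.map (G (p i)) (e i)) →
      Tendsto (fun i => (g i).1) F (𝓝 x) → x = Cone.map (G r) y := by
    intro e p g y x r he hp hg hx
    have h1 : Tendsto (fun i => Cone.map (G (p i)) (e i)) F (𝓝 (Cone.map (G r) y)) :=
      (hG.tendsto (y, r)).comp (he.prodMk_nhds hp)
    exact tendsto_nhds_unique hx (h1.congr fun i => (hg i).symm)
  have ea := key ha₀ hs hh ha
  have eb := key hb₀ ht hh' hb
  rw [ea, eb, Cone.height_map, Cone.height_map] at hab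
  have e : a₀ = b₀ := continuouslyControlled.eq_of_tendsto hM
    (mem_of_superset hS hcd) ha₀ hb₀ hab
  have h2 : a₀.height = 1 := hab.elim id fun h => e ▸ h
  have h3 : Tendsto (fun i => ((level (c i) : ℝ≥0) : ℝ)) F atTop :=
    NNReal.tendsto_coe_atTop.2 (tendsto_level_atTop ha₀ h2)
  have h4 : Tendsto (fun i => ((D : ℝ) + C) / ((level (c i) : ℝ) + 1)) F (𝓝 0) :=
    (tendsto_atTop_add_const_right _ 1 h3).const_div_atTop _
  have h5 : Tendsto (fun i => dist (param (u i) (level (c i))) (param (u' i) (level (d i)))) F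
      (𝓝 0) :=
    squeeze_zero' (.of_forall fun _ => dist_nonneg)
      (mem_of_superset hS fun i hi => dist_param_le (hud i hi) (hD i hi) (hC i hi)) h4
  have est : s = t := dist_eq_zero.1 (tendsto_nhds_unique (hs.dist ht) h5)
  rw [ea, eb, e, est]

/-- The coarse homotopy sends `(q, t)` to the time `t / (level + 1)` of `F` and leaves the ray
coordinate unchanged. It starts at time `0`, and at `t = level + 1` it reaches time `1`. -/
theorem elementaryHomotopic_map {f₀ f₁ : X ⟶ Y}
    (F : ContinuousMap.Homotopy f₀.hom.hom f₁.hom.hom) :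
    CoarseSpace.ElementaryHomotopic (map f₀) (map f₁) := by
  have hcont : Continuous fun p : Cone X × I => Cone.map (F.curry p.2) p.1 :=
    Cone.continuous_map_family F.curry (F.continuous.comp continuous_swap)
  let h : ((coneGraph X).cylinder metricRay fun q => q.1.2).carrier → OpenCone Y := fun q =>
    ⟨Cone.map (F.curry (param q.1.2 (level q.1.1.1.1))) q.1.1.1.1.1, by
      rw [Cone.height_map]; exact q.1.1.1.1.2⟩
  have hh : ∀ q, level (h q) = q.1.1.1.2 := fun q =>
    (level_congr (d := q.1.1.1.1) (Cone.height_map _ _)).trans (level_eq q.1.1)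
  refine ⟨metricRay, fun q => q.1.2, isGeneralisedRay_metricRay, isCoarseMap_snd,
    ⟨fun q => ⟨(h q, q.1.1.1.2), (hh q).ge, (hh q).le⟩, ?_, ?_⟩, fun q => ?_, fun q => ?_⟩
  · intro M hM
    obtain ⟨h1, D, hD⟩ := prod_controlled_iff.1 hM
    obtain ⟨h1, C, hC⟩ := controlled_iff.1 h1
    refine controlled_iff.2 ⟨?_, C, forall_mem_image.2 fun p hp => hC _ ⟨_, ⟨p, hp, rfl⟩, rfl⟩⟩
    refine (continuouslyControlled Y).subset (controlled_map_family hcont (S := M)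
      (c := fun p => p.1.1.1.1.1) (d := fun p => p.2.1.1.1.1) (u := fun p => p.1.1.2)
      (u' := fun p => p.2.1.2) (h := fun p => h p.1) (h' := fun p => h p.2)
      (fun _ => rfl) (fun _ => rfl) h1
      (fun p hp => ⟨_, ⟨_, ⟨p, hp, rfl⟩, rfl⟩, rfl⟩) (fun p _ => ?_) (C := C) (D := D)
      (fun p hp => ?_) (fun p hp => hD _ ⟨_, ⟨p, hp, rfl⟩, rfl⟩)) (by
        rintro _ ⟨_, ⟨p, hp, rfl⟩, rfl⟩
        exact ⟨p, hp, rfl⟩)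
    · exact p.2.2.trans (add_le_add_left (level_eq p.2.1.1).ge 1)
    · have e1 := level_eq p.1.1.1
      have e2 := level_eq p.2.1.1
      rw [e1, e2]
      exact hC _ ⟨_, ⟨p, hp, rfl⟩, rfl⟩
  · intro B hB
    obtain ⟨n, hn⟩ := bounded_iff.1 hB
    refine sub_bounded_iff.2 (prod_bounded_iff.2 ⟨bounded_iff.2 ⟨n, ?_⟩,
      metricRay_bounded_iff.2 ⟨n + 1, ?_⟩⟩)
    · rintro _ ⟨_, ⟨q, hq, rfl⟩, rfl⟩
      exact hn _ hq
    · rintro _ ⟨_, ⟨q, hq, rfl⟩, rfl⟩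
      exact le_trans q.2 (add_le_add_left (hn _ hq) 1)
  · apply Subtype.ext
    refine Prod.ext (Subtype.ext ?_) rfl
    change Cone.map _ _ = Cone.map (F.curry (param 0 (level q.1.1))) _
    rw [param_zero, F.curry_zero]
  · apply Subtype.ext
    refine Prod.ext (Subtype.ext ?_) rfl
    change Cone.map _ _ = Cone.map (F.curry (param (q.1.2 + 1) (level q.1.1))) _
    rw [level_eq, param_self, F.curry_one]

theorem isCoarseHomotopyEquiv_map (f : X ⟶ Y) (g : Y ⟶ X)
    (hfg : ContinuousMap.Homotopic (f ≫ g).hom.hom (𝟙 X : X ⟶ X).hom.hom)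
    (hgf : ContinuousMap.Homotopic (g ≫ f).hom.hom (𝟙 Y : Y ⟶ Y).hom.hom) :
    CoarseSpace.IsCoarseHomotopyEquiv (map f) := by
  refine ⟨map g, ?_, ?_⟩
  · rw [← map_comp, ← map_id]
    exact .rel _ _ (elementaryHomotopic_map hfg.some)
  · rw [← map_comp, ← map_id]
    exact .rel _ _ (elementaryHomotopic_map hgf.some)

/-- The projection of the part below the graph to the open cone. -/
def belowProj (X : CompHaus.{u}) : (coneProd X).sub (belowGraph X) ⟶ openCone X where
  toFun q := q.1.1
  isCoarse :=
    { controlled := fun M hM => by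
        refine (continuouslyControlled X).subset (prod_controlled_iff.1 hM).1 ?_
        rintro _ ⟨p, hp, rfl⟩
        exact ⟨_, ⟨p, hp, rfl⟩, rfl⟩
      proper := fun B hB => by
        obtain ⟨n, hn⟩ := continuouslyControlled.bounded_iff.1 hB
        refine sub_bounded_iff.2 (prod_bounded_iff.2
          ⟨continuouslyControlled.bounded_iff.2 ⟨n, ?_⟩, metricRay_bounded_iff.2 ⟨n, ?_⟩⟩)
        · rintro _ ⟨_, ⟨q, hq, rfl⟩, rfl⟩
          exact hn _ hq
        · rintro _ ⟨_, ⟨q, hq, rfl⟩, rfl⟩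
          exact le_trans q.2 (hn _ hq) }

/-- The inclusion of the open cone in the part below the graph, at height zero. -/
def belowZero (X : CompHaus.{u}) : openCone X ⟶ (coneProd X).sub (belowGraph X) where
  toFun c := ⟨(c, 0), bot_le (a := level c)⟩
  isCoarse :=
    { controlled := fun M hM => by
        refine prod_controlled_iff.2 ⟨?_, 0, ?_⟩
        · refine (continuouslyControlled X).subset hM ?_
          rintro _ ⟨_, ⟨_, ⟨p, hp, rfl⟩, rfl⟩, rfl⟩
          exact hp
        · rintro _ ⟨_, ⟨_, ⟨p, hp, rfl⟩, rfl⟩, rfl⟩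
          exact ⟨bot_le, bot_le⟩
      proper := fun B hB => by
        obtain ⟨n, hn⟩ := continuouslyControlled.bounded_iff.1
          (prod_bounded_iff.1 (sub_bounded_iff.1 hB)).1
        exact continuouslyControlled.bounded_iff.2 ⟨n, fun c hc => hn _ ⟨_, ⟨_, hc, rfl⟩, rfl⟩⟩ }

/-- The projection of the graph to the open cone. -/
def proj (X : CompHaus.{u}) : coneGraph X ⟶ openCone X :=
  (coneProd X).inclOfLE inter_subset_left ≫ belowProj X

theorem map_proj (f : X ⟶ Y) : map f ≫ proj Y = proj X ≫ openConeMap f := rfl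

end coneGraph

/-! ### Homotopy invariance. -/

open TopSpectrum

theorem TopSpectrum.mapPi_map_comp (E : CoarseSpace.{u} ⥤ TopSpectrum.{v}) {X Y Z : CoarseSpace.{u}}
    (f : X ⟶ Y) (g : Y ⟶ Z) (k : ℤ) :
    Hom.mapPi (E.map (f ≫ g)) k = Hom.mapPi (E.map g) k ∘ Hom.mapPi (E.map f) k :=
  Hom.mapPi_comp_of_app _ _ _ (fun n x => by rw [E.map_comp]; rfl) k

theorem TopSpectrum.mapPi_map_id (E : CoarseSpace.{u} ⥤ TopSpectrum.{v}) (X : CoarseSpace.{u})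
    (k : ℤ) : Hom.mapPi (E.map (𝟙 X)) k = id :=
  Hom.mapPi_eq_id _ (fun n x => by rw [E.map_id]; rfl) k

namespace IsCoarselyExcisive

variable {E : CoarseSpace.{u} ⥤ TopSpectrum.{v}} {X Y : CompHaus.{u}}

/-- The projection factors through the part below the graph. The first map is onto by the pushout
over the flasque space; the second has the section `coneGraph.belowZero`. -/
theorem mapPi_proj_surjective (hE : IsCoarselyExcisive E) (X : CompHaus.{u}) (k : ℤ) :
    Function.Surjective (Hom.mapPi (E.map (coneGraph.proj X)) k) := by
  rw [coneGraph.proj, mapPi_map_comp]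
  refine Function.Surjective.comp (fun a => ⟨Hom.mapPi (E.map (coneGraph.belowZero X)) k a, ?_⟩)
    (IsHomotopyPushout.mapPi_surjective
      (hE.excision _ _ _ (coarselyExcisiveDecomposition_graph X))
      (hE.flasque _ (flasque_coneProd X)) k)
  rw [← Function.comp_apply (f := Hom.mapPi _ k), ← mapPi_map_comp]
  exact congrFun (mapPi_map_id E (openCone X) k) a

/-- In the naturality square of `coneGraph.proj`, the composite through the graph of `Y` is a
bijection followed by a surjection; hence the last map of the other composite is onto. -/
theorem mapPi_openConeMap_surjective (hE : IsCoarselyExcisive E) (f : X ⟶ Y) (g : Y ⟶ X)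
    (hfg : ContinuousMap.Homotopic (f ≫ g).hom.hom (𝟙 X : X ⟶ X).hom.hom)
    (hgf : ContinuousMap.Homotopic (g ≫ f).hom.hom (𝟙 Y : Y ⟶ Y).hom.hom) (k : ℤ) :
    Function.Surjective (Hom.mapPi (E.map (openConeMap f)) k) := by
  refine Function.Surjective.of_comp (g := Hom.mapPi (E.map (coneGraph.proj X)) k) ?_
  rw [← mapPi_map_comp, ← coneGraph.map_proj, mapPi_map_comp]
  exact (hE.mapPi_proj_surjective Y k).comp
    (hE.homotopy _ _ _ (coneGraph.isCoarseHomotopyEquiv_map f g hfg hgf) k).surjective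

/-- It is enough to compare the two end inclusions of `I × X`. Both are sections of the projection
`pr`, and one of them is onto on `π_k`; so it is inverse to `pr`, and the other section must equal
it. -/
theorem mapPi_openConeMap_eq (hE : IsCoarselyExcisive E) {f₀ f₁ : X ⟶ Y}
    (h : ContinuousMap.Homotopic f₀.hom.hom f₁.hom.hom) (k : ℤ) :
    Hom.mapPi (E.map (openConeMap f₀)) k = Hom.mapPi (E.map (openConeMap f₁)) k := by
  obtain ⟨F⟩ := h
  let i (t : I) : X ⟶ CompHaus.of (I × X) := CompHausLike.ofHom _ ⟨fun x => (t, x), by fun_prop⟩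
  let pr : CompHaus.of (I × X) ⟶ X := CompHausLike.ofHom _ ⟨Prod.snd, continuous_snd⟩
  let Φ : CompHaus.of (I × X) ⟶ Y := CompHausLike.ofHom _ F.toContinuousMap
  have hi (t : I) : i t ≫ pr = 𝟙 X := rfl
  have h0 : f₀ = i 0 ≫ Φ := by
    ext x; exact (F.apply_zero x).symm
  have h1 : f₁ = i 1 ≫ Φ := by
    ext x; exact (F.apply_one x).symm
  have hcomp {A B C : CompHaus.{u}} (f : A ⟶ B) (g : B ⟶ C) :
      Hom.mapPi (E.map (openConeMap (f ≫ g))) k =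
        Hom.mapPi (E.map (openConeMap g)) k ∘ Hom.mapPi (E.map (openConeMap f)) k := by
    rw [← mapPi_map_comp]
    exact congrArg (fun φ => Hom.mapPi (E.map φ) k) (openConeFunctor.map_comp f g)
  have hleft (t : I) :
      Hom.mapPi (E.map (openConeMap pr)) k ∘ Hom.mapPi (E.map (openConeMap (i t))) k = id := by
    rw [← hcomp, hi, ← mapPi_map_id E (openCone X) k]
    exact congrArg (fun φ => Hom.mapPi (E.map φ) k) (openConeFunctor.map_id X)
  have hsurj : Function.Surjective (Hom.mapPi (E.map (openConeMap (i 0))) k) := by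
    -- The inclusion at `0` is a homotopy equivalence with inverse `pr`: multiplication on `I`
    -- contracts it to `0`.
    refine hE.mapPi_openConeMap_surjective (i 0) pr (.refl _) ⟨⟨⟨fun p => (p.1 * p.2.1, p.2.2),
      by fun_prop⟩, fun x => ?_, fun x => ?_⟩⟩ k
    · exact Prod.ext (zero_mul _) rfl
    · exact Prod.ext (one_mul _) rfl
  have hi01 : Hom.mapPi (E.map (openConeMap (i 1))) k =
      Hom.mapPi (E.map (openConeMap (i 0))) k := by
    funext a
    obtain ⟨b, hb⟩ := hsurj (Hom.mapPi (E.map (openConeMap (i 1))) k a)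
    have e0 := congrFun (hleft 0) b
    have e1 := congrFun (hleft 1) a
    simp only [Function.comp_apply, id] at e0 e1
    rw [hb, e1] at e0
    rw [← hb, e0]
  rw [h0, h1, hcomp, hcomp, hi01]

theorem isWeakEquiv_openConeMap (hE : IsCoarselyExcisive E) (f : X ⟶ Y) (g : Y ⟶ X)
    (hfg : ContinuousMap.Homotopic (f ≫ g).hom.hom (𝟙 X : X ⟶ X).hom.hom)
    (hgf : ContinuousMap.Homotopic (g ≫ f).hom.hom (𝟙 Y : Y ⟶ Y).hom.hom) :
    Hom.IsWeakEquiv (E.map (openConeMap f)) := by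
  intro k
  have hcomp {A B : CompHaus.{u}} (f : A ⟶ B) (g : B ⟶ A)
      (h : ContinuousMap.Homotopic (f ≫ g).hom.hom (𝟙 A : A ⟶ A).hom.hom) :
      Hom.mapPi (E.map (openConeMap g)) k ∘ Hom.mapPi (E.map (openConeMap f)) k = id := by
    rw [← mapPi_map_comp, ← mapPi_map_id E (openCone A) k]
    refine (congrArg (fun φ => Hom.mapPi (E.map φ) k) (openConeFunctor.map_comp f g)).symm.trans
      ((hE.mapPi_openConeMap_eq h k).trans ?_)
    exact congrArg (fun φ => Hom.mapPi (E.map φ) k) (openConeFunctor.map_id A)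
  exact Function.bijective_iff_has_inverse.2 ⟨Hom.mapPi (E.map (openConeMap g)) k,
    congrFun (hcomp f g hfg), congrFun (hcomp g f hgf)⟩

end IsCoarselyExcisive

/-! ### Excision for open covers. -/

-- Otherwise pairs in `M` over `K` and `L` would escape to infinity. Their common limit there would
-- have a base point in both closed sets.
open Filter in
theorem continuouslyControlled.exists_level_le_of_disjoint {X : Type u} [TopologicalSpace X]
    [CompactSpace X] [T2Space X] {M : Set (OpenCone X × OpenCone X)}
    (hM : (continuouslyControlled X).Controlled M) {K L : Set X} (hK : IsClosed K)
    (hL : IsClosed L) (hKL : Disjoint K L) :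
    ∃ n, ∀ p ∈ M, (∃ x ∈ K, p.1.1 = Cone.mk x p.1.1.height) →
      (∃ y ∈ L, p.2.1 = Cone.mk y p.2.1.height) → level p.2 ≤ n := by
  by_contra! H
  choose p hpM hpx hpy hp using fun k : ℕ => H k
  choose x hxK hx using hpx
  choose y hyL hy using hpy
  have h2 : Tendsto (fun k => level (p k).2) (hyperfilter ℕ : Filter ℕ) atTop :=
    (tendsto_atTop_mono (fun k => (hp k).le) tendsto_natCast_atTop_atTop).mono_left
      Nat.hyperfilter_le_atTop
  obtain ⟨a, ha⟩ := (hyperfilter ℕ).exists_tendsto_of_compactSpace fun k => (p k).1.1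
  obtain ⟨b, hb⟩ := (hyperfilter ℕ).exists_tendsto_of_compactSpace fun k => (p k).2.1
  obtain ⟨x₀, hx₀⟩ := (hyperfilter ℕ).exists_tendsto_of_compactSpace x
  obtain ⟨y₀, hy₀⟩ := (hyperfilter ℕ).exists_tendsto_of_compactSpace y
  have hb1 := height_eq_one_of_tendsto hb h2
  have e : a = b := eq_of_tendsto hM (.of_forall hpM) ha hb (Or.inr hb1)
  have ea := Cone.eq_mk_of_tendsto (.of_forall hx) hx₀ ha
  have eb := Cone.eq_mk_of_tendsto (.of_forall hy) hy₀ hb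
  have hxy : x₀ = y₀ := Cone.mk_injective (ea.symm.trans (e.trans eb)) (by
    rw [e, hb1]; exact one_pos)
  exact Set.disjoint_left.1 hKL (hK.mem_of_tendsto hx₀ (.of_forall hxK))
    (hxy ▸ hL.mem_of_tendsto hy₀ (.of_forall hyL))

section Excision

variable (X : CompHaus.{u}) {U V : Set X}

theorem openConeOver_inter : openConeOver X (U ∩ V) = openConeOver X U ∩ openConeOver X V := by
  refine Subset.antisymm (subset_inter (openConeOver_mono X inter_subset_left)
    (openConeOver_mono X inter_subset_right)) ?_
  rintro c ⟨hc | ⟨x, hx, t, ht⟩, hc'⟩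
  · exact Or.inl hc
  rcases hc' with hc | ⟨y, hy, s, hs⟩
  · exact Or.inl hc
  by_cases h : c.1.height = 0
  · exact Or.inl h
  · have h0 : 0 < t := by
      rw [ht] at h
      exact unitInterval.pos_iff_ne_zero.2 h
    obtain rfl : x = y := Cone.mk_injective (ht.symm.trans hs) h0
    exact Or.inr ⟨x, ⟨hx, hy⟩, t, ht⟩

theorem exists_eq_mk_of_notMem_openConeOver {c : (openCone X).carrier}
    (hc : c ∉ openConeOver X U) : ∃ x ∈ Uᶜ, c.1 = Cone.mk x c.1.height := by
  obtain ⟨x, hx⟩ := Cone.exists_eq_mk_of_height_ne fun h => hc (Or.inl h)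
  exact ⟨x, fun hxU => hc (Or.inr ⟨x, hxU, _, hx⟩), hx⟩

/-- Let `c` be related to `a` over `U` and to `b` over `V`. If none of `a`, `b`, `c` lies over `U ∩
V`, then `c` is related to a point over the complement of one set while lying itself over the
complement of the other, so its level is bounded. -/
theorem coarselyExcisiveDecomposition_openConeOver (hU : IsOpen U) (hV : IsOpen V)
    (hUV : U ∪ V = univ) :
    (openCone X).CoarselyExcisiveDecomposition (openConeOver X U) (openConeOver X V) := by
  have hdisj : Disjoint Uᶜ Vᶜ := by
    rw [disjoint_compl_left_iff_subset, compl_subset_iff_union, union_comm]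
    exact hUV
  refine ⟨eq_univ_of_forall fun c => ?_, fun m hm => ?_⟩
  · by_contra h
    rw [mem_union, not_or] at h
    obtain ⟨x, hx, -⟩ := exists_eq_mk_of_notMem_openConeOver X h.1
    obtain ⟨y, hy, hy'⟩ := exists_eq_mk_of_notMem_openConeOver X h.2
    rcases (hUV ▸ mem_univ y : y ∈ U ∪ V) with h' | h'
    · exact h.1 (Or.inr ⟨y, h', _, hy'⟩)
    · exact hy h'
  · obtain ⟨n, hn⟩ := continuouslyControlled.exists_level_le_of_disjoint hm hV.isClosed_compl
      hU.isClosed_compl hdisj.symm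
    obtain ⟨n', hn'⟩ := continuouslyControlled.exists_level_le_of_disjoint hm hU.isClosed_compl
      hV.isClosed_compl hdisj
    let B : Set (OpenCone X) := {c | level c ≤ max n n'}
    -- The apex lies over both sets by definition, so it serves the whole bounded region `B`.
    let o : OpenCone X := ⟨Cone.apex X, zero_lt_one⟩
    have ho : o ∈ B := (level_eq_zero rfl : level o = 0).trans_le bot_le
    have ho' : o ∈ openConeOver X U ∩ openConeOver X V := ⟨Or.inl rfl, Or.inl rfl⟩
    have hB : (continuouslyControlled X).Bounded B := continuouslyControlled.bounded_level_le _
    refine ⟨(m ∪ {p | p.1 = p.2}) ∪ B ×ˢ B,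
      (openCone X).str.union ((openCone X).str.union hm (openCone X).str.diag) (hB.prod hB), ?_⟩
    rintro c ⟨⟨a, ha, hac⟩, ⟨b, hb, hbc⟩⟩
    by_cases hcU : c ∈ openConeOver X U
    · by_cases hcV : c ∈ openConeOver X V
      · exact ⟨c, ⟨hcU, hcV⟩, Or.inl (Or.inr rfl)⟩
      by_cases hbU : b ∈ openConeOver X U
      · exact ⟨b, ⟨hbU, hb⟩, Or.inl (Or.inl hbc)⟩
      refine ⟨o, ho', Or.inr ⟨ho, (le_max_of_le_right ?_ : level c ≤ max n n')⟩⟩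
      exact hn' (b, c) hbc (exists_eq_mk_of_notMem_openConeOver X hbU)
        (exists_eq_mk_of_notMem_openConeOver X hcV)
    · by_cases haV : a ∈ openConeOver X V
      · exact ⟨a, ⟨ha, haV⟩, Or.inl (Or.inl hac)⟩
      refine ⟨o, ho', Or.inr ⟨ho, (le_max_of_le_left ?_ : level c ≤ max n n')⟩⟩
      exact hn (a, c) hac (exists_eq_mk_of_notMem_openConeOver X haV)
        (exists_eq_mk_of_notMem_openConeOver X hcU)

/-- The cone over `U ∩ V` equals the intersection of cones only propositionally. A variable `S` for
it lets the equation be substituted, without transport along an equality of coarse spaces. -/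
theorem IsCoarselyExcisive.isHomotopyPushout_openConeOver {E : CoarseSpace.{u} ⥤ TopSpectrum.{v}}
    (hE : IsCoarselyExcisive E) (hU : IsOpen U) (hV : IsOpen V) (hUV : U ∪ V = univ)
    {S : Set (openCone X).carrier} (hS : S = openConeOver X U ∩ openConeOver X V)
    (h₁ : S ⊆ openConeOver X U) (h₂ : S ⊆ openConeOver X V) :
    TopSpectrum.IsHomotopyPushout (E.map ((openCone X).inclOfLE h₁))
      (E.map ((openCone X).inclOfLE h₂)) (E.map ((openCone X).subIncl (openConeOver X U)))
      (E.map ((openCone X).subIncl (openConeOver X V))) := by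
  subst hS
  exact hE.excision _ _ _ (coarselyExcisiveDecomposition_openConeOver X hU hV hUV)

end Excision

/-! ### Disjoint unions. -/

theorem IsCoarseMap.bounded_image {X : Type u} {Y : Type v} {s : CoarseStructure X}
    {t : CoarseStructure Y} {f : X → Y} (hf : IsCoarseMap s t f) {B : Set X} (hB : s.Bounded B) :
    t.Bounded (f '' B) := by
  rw [bounded_iff_prod, ← prodMap_image_prod]
  exact hf.controlled _ (hB.prod hB)

/-- The homotopy is `f₀` at `t = 0` and jumps to `f₁` for `t > 0`. Coarse maps need not be
continuous, and closeness absorbs the jump. The map `p` is only needed to provide the cylinder;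
properness holds because `t ≤ p x + 1` and `p` is bounded on bounded sets. -/
theorem CoarseSpace.elementaryHomotopic_of_close {X Y : CoarseSpace.{u}} {f₀ f₁ : X ⟶ Y}
    (h : Y.str.Close f₀.toFun f₁.toFun) {p : X.carrier → ℝ≥0}
    (hp : IsCoarseMap X.str properRay p) : ElementaryHomotopic f₀ f₁ := by
  classical
  refine ⟨properRay, p, isGeneralisedRay_properRay, hp,
    ⟨fun q => if q.1.2 = 0 then f₀.toFun q.1.1 else f₁.toFun q.1.1, ?_, ?_⟩, fun x => ?_,
    fun x => ?_⟩
  · intro M hM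
    have h1 := (prod_controlled_iff.1 hM).1
    refine Y.str.subset (Y.str.union
      (Y.str.union (f₀.isCoarse.controlled _ h1)
        (Y.str.comp (f₀.isCoarse.controlled _ h1) h))
      (Y.str.union (Y.str.comp (Y.str.symm h) (f₀.isCoarse.controlled _ h1))
        (f₁.isCoarse.controlled _ h1))) ?_
    rintro _ ⟨⟨a, b⟩, hab, rfl⟩
    have hM₁ : (a.1.1, b.1.1) ∈ (fun p : (X.carrier × ℝ≥0) × (X.carrier × ℝ≥0) =>
        (p.1.1, p.2.1)) '' (Prod.map Subtype.val Subtype.val '' M) := ⟨_, ⟨_, hab, rfl⟩, rfl⟩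
    simp only [Prod.map_apply]
    split_ifs with ha hb hb
    · exact Or.inl (Or.inl ⟨_, hM₁, rfl⟩)
    · exact Or.inl (Or.inr ⟨_, ⟨_, hM₁, rfl⟩, ⟨_, rfl⟩⟩)
    · exact Or.inr (Or.inl ⟨_, ⟨a.1.1, rfl⟩, ⟨_, hM₁, rfl⟩⟩)
    · exact Or.inr (Or.inr ⟨_, hM₁, rfl⟩)
  · intro B hB
    have h0 := f₀.isCoarse.proper B hB
    have h1 := f₁.isCoarse.proper B hB
    have h01 : X.str.Bounded (f₀.toFun ⁻¹' B ∪ f₁.toFun ⁻¹' B) := by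
      rw [bounded_iff_prod, prod_union, union_prod, union_prod]
      exact X.str.union (X.str.union (h0.prod h0) (h1.prod h0))
        (X.str.union (h0.prod h1) (h1.prod h1))
    obtain ⟨n, hn⟩ : ∃ n, ∀ x ∈ f₀.toFun ⁻¹' B ∪ f₁.toFun ⁻¹' B, p x ≤ n := by
      obtain ⟨n, hn⟩ := exists_le_of_properRay_bounded (hp.bounded_image h01)
      exact ⟨n, fun x hx => hn _ ⟨x, hx, rfl⟩⟩
    have key : ∀ q : (X.cylinder properRay p).carrier,
        (if q.1.2 = 0 then f₀.toFun q.1.1 else f₁.toFun q.1.1) ∈ B →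
        q.1.1 ∈ f₀.toFun ⁻¹' B ∪ f₁.toFun ⁻¹' B := by
      intro q hq
      split_ifs at hq
      · exact Or.inl hq
      · exact Or.inr hq
    refine sub_bounded_iff.2 (prod_bounded_iff.2 ⟨h01.mono ?_, bounded_of_prod
      (properRay_controlled_of_le (n := n + 1) ?_)⟩)
    · rintro _ ⟨_, ⟨q, hq, rfl⟩, rfl⟩
      exact key q hq
    · have h2 : ∀ r ∈ Prod.snd '' (Subtype.val '' ((fun q : (X.cylinder properRay p).carrier =>
          if q.1.2 = 0 then f₀.toFun q.1.1 else f₁.toFun q.1.1) ⁻¹' B)), r ≤ n + 1 := by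
        rintro _ ⟨_, ⟨q, hq, rfl⟩, rfl⟩
        exact le_trans q.2 (add_le_add_left (hn _ (key q hq)) 1)
      exact fun r hr => ⟨h2 _ hr.1, h2 _ hr.2⟩
  · exact (if_pos rfl).symm
  · exact (if_neg (by simp)).symm

namespace TopSpectrum

section ConstLoop

variable (A : TopSpectrum.{v})

theorem mk_constLoop_eq {k : ℤ} {n m n' m' : ℕ} (h : (m : ℤ) = n + k) (h' : (m' : ℤ) = n' + k) :
    (Quot.mk _ ⟨n, m, h, A.constLoop n m⟩ : StablePi A k) =
      Quot.mk _ ⟨n', m', h', A.constLoop n' m'⟩ := by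
  have key : ∀ (d n m n' m' : ℕ) (h : (m : ℤ) = n + k) (h' : (m' : ℤ) = n' + k), n' = n + d →
      (Quot.mk _ ⟨n, m, h, A.constLoop n m⟩ : StablePi A k) =
        Quot.mk _ ⟨n', m', h', A.constLoop n' m'⟩ := by
    intro d
    induction d with
    | zero =>
      intro n m n' m' h h' e
      obtain rfl : n' = n := e
      obtain rfl : m' = m := by omega
      rfl
    | succ d ih =>
      intro n m n' m' h h' e
      refine Eq.trans ?_ (ih (n + 1) (m + 1) n' m' (by push_cast; omega) h' (by omega))
      rw [← stab_constLoop]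
      exact Quot.sound (StableRel.stab n m h _)
  rcases le_total n n' with hn | hn
  · exact key (n' - n) n m n' m' h h' (by omega)
  · exact (key (n - n') n' m' n m h' h (by omega)).symm

theorem nonempty_stablePi (k : ℤ) : Nonempty (StablePi A k) :=
  -- The level `n = |k|` makes `n + k` nonnegative, also for negative `k`.
  ⟨Quot.mk _ ⟨k.natAbs, (k.natAbs + k).toNat, by omega, A.constLoop _ _⟩⟩

variable {A}

theorem weaklyContractible_of_subsingleton (h : ∀ n, Subsingleton (A.space n)) :
    A.WeaklyContractible := by
  intro k
  have key : ∀ r : StableRep A k, r = ⟨r.n, r.m, r.index, A.constLoop r.n r.m⟩ := by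
    rintro ⟨n, m, hi, γ⟩
    congr 1
    apply Subtype.ext
    ext y
    exact (h n).elim _ _
  refine ⟨fun a b => ?_⟩
  induction a using Quot.ind with | mk r => ?_
  induction b using Quot.ind with | mk r' => ?_
  rw [key r, key r']
  exact A.mk_constLoop_eq _ _

/-- The trivial map of spectra. -/
def zeroHom (A : TopSpectrum.{v}) (B : TopSpectrum.{w}) : Hom A B where
  app n := ContinuousMap.const _ (B.pt n)
  app_pt _ := rfl
  app_adj n _ s := (B.adj_pt n s).symm

/-- The trivial map sends every representative to a constant loop, and all constant loops give the
same class in `StablePi`. -/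
theorem weaklyContractible_of_mapPi_zeroHom
    (h : ∀ k, (zeroHom A A).mapPi k = id) : A.WeaklyContractible := by
  intro k
  refine ⟨fun a b => ?_⟩
  refine (congrFun (h k) a).symm.trans (Eq.trans ?_ (congrFun (h k) b))
  induction a using Quot.ind with | mk r => ?_
  induction b using Quot.ind with | mk r' => ?_
  exact A.mk_constLoop_eq r.index r'.index

/-- The inclusion of a summand in a wedge of spectra. -/
def wedgeIncl {ι : Type u} (A : ι → TopSpectrum.{v}) (i : ι) : Hom (A i) (wedge A) where
  app n := wedgeIn A n i
  app_pt _ := Quot.sound (WedgeRel.base i)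
  app_adj _ _ _ := rfl

theorem mapPi_wedgeDesc_wedgeIncl {ι : Type u} {A : ι → TopSpectrum.{v}} {B : TopSpectrum.{w}}
    (f : ∀ i, Hom (A i) B) (i : ι) (k : ℤ) :
    (f i).mapPi k = (wedgeDesc f).mapPi k ∘ (wedgeIncl A i).mapPi k :=
  Hom.mapPi_comp_of_app _ _ _ (fun _ _ => rfl) k

end ConstLoop

end TopSpectrum

section DisjointUnion

variable {ι : Type u} {K : ι → CompHaus.{u}} {L : CompHaus.{u}} {j : ∀ i, K i ⟶ L}

/-- The images of the summands are disjoint and open and cover the compact space `L`. -/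
theorem finite_setOf_nonempty
    (hj : IsHomeomorph (fun p : Σ i, K i => (j p.1).hom.hom p.2)) :
    {i | Nonempty (K i)}.Finite := by
  obtain ⟨t, ht⟩ := isCompact_univ.elim_finite_subcover (fun i => range (j i).hom.hom)
    (fun i => by
      have := (hj.isOpenMap.comp (isOpenMap_sigmaMk (i := i))).isOpen_range
      exact this)
    (fun y _ => by
      obtain ⟨⟨i, x⟩, hx⟩ := hj.surjective y
      exact mem_iUnion.2 ⟨i, x, hx⟩)
  refine t.finite_toSet.subset ?_
  rintro i ⟨x⟩
  obtain ⟨i', hi', x', hx'⟩ := mem_iUnion₂.1 (ht (mem_univ ((j i).hom.hom x)))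
  have : (⟨i', x'⟩ : Σ i, K i) = ⟨i, x⟩ := hj.injective hx'
  obtain rfl := congrArg Sigma.fst this
  exact hi'

/-- The map `⋁ 𝒪(K i) → 𝒪L` induced by maps `K i → L`. -/
def coneSum (j : ∀ i, K i ⟶ L) (x : Σ i, OpenCone (K i)) : OpenCone L :=
  (openConeMap (j x.1)).toFun x.2

theorem coneSum_height (x : Σ i, OpenCone (K i)) : (coneSum j x).1.height = x.2.1.height :=
  Cone.height_map _ _

theorem coneSum_level (x : Σ i, OpenCone (K i)) : level (coneSum j x) = level x.2 :=
  level_openConeMap _ _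

theorem level_eq_zero_of_isEmpty {X : Type u} (h : ¬ Nonempty X)
    (c : OpenCone X) : level c = 0 := by
  refine level_eq_zero ?_
  by_contra hc
  obtain ⟨x, -⟩ := Cone.exists_eq_mk_of_height_ne hc
  exact h ⟨x⟩

/-- The index type may be infinite, but empty summands contribute only apexes, of level `0`; the
bound is a maximum over finitely many summands. -/
theorem exists_forall_level_le (hK : {i | Nonempty (K i)}.Finite) {B : ∀ i, Set (OpenCone (K i))}
    (hB : ∀ i, (continuouslyControlled (K i)).Bounded (B i)) :
    ∃ n, ∀ i, ∀ c ∈ B i, level c ≤ n := by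
  choose n hn using fun i => continuouslyControlled.bounded_iff.1 (hB i)
  refine ⟨hK.toFinset.sup n, fun i c hc => ?_⟩
  by_cases hi : Nonempty (K i)
  · exact (hn i c hc).trans (Finset.le_sup (f := n) (hK.mem_toFinset.2 hi))
  · exact (level_eq_zero_of_isEmpty hi c).trans_le bot_le

theorem disjUnion_bounded_level_le (K : ι → CompHaus.{u}) (n : ℝ≥0) :
    (CoarseStructure.disjUnion fun i => continuouslyControlled (K i)).Bounded
      {x | level x.2 ≤ n} := by
  refine bounded_of_prod ⟨fun _ => ∅, fun i => {c | level c ≤ n}, fun i =>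
    (continuouslyControlled (K i)).subset (continuouslyControlled (K i)).diag (empty_subset _),
    fun i => continuouslyControlled.bounded_level_le n, ?_⟩
  rintro ⟨⟨i, c⟩, ⟨i', c'⟩⟩ ⟨hc, hc'⟩
  exact Or.inr (mem_iUnion₂.2 ⟨i, i', ⟨c, hc, rfl⟩, ⟨c', hc', rfl⟩⟩)

theorem isCoarseMap_coneSum (hK : {i | Nonempty (K i)}.Finite) (j : ∀ i, K i ⟶ L) :
    IsCoarseMap (CoarseStructure.disjUnion fun i => continuouslyControlled (K i))
      (continuouslyControlled L) (coneSum j) where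
  controlled := by
    rintro M ⟨N, B, hN, hB, hM⟩
    obtain ⟨n, hn⟩ := exists_forall_level_le hK hB
    have hb := continuouslyControlled.bounded_level_le (X := L) n
    refine (continuouslyControlled L).subset ((continuouslyControlled L).union
      ((continuouslyControlled L).controlled_biUnion hK
        (fun i => Prod.map (openConeMap (j i)).toFun (openConeMap (j i)).toFun '' N i)
        fun i _ => (openConeMap (j i)).isCoarse.controlled _ (hN i)) (hb.prod hb)) ?_
    rintro _ ⟨p, hp, rfl⟩
    rcases hM hp with hp | hp
    · obtain ⟨i, q, hq, rfl⟩ := mem_iUnion.1 hp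
      by_cases hi : Nonempty (K i)
      · exact Or.inl (mem_iUnion₂.2 ⟨i, hi, q, hq, rfl⟩)
      · have key : ∀ c : OpenCone (K i), level (coneSum j ⟨i, c⟩) ≤ n := fun c =>
          ((coneSum_level _).trans (level_eq_zero_of_isEmpty hi c)).trans_le bot_le
        exact Or.inr ⟨key q.1, key q.2⟩
    · obtain ⟨i, i', ⟨c, hc, e⟩, ⟨c', hc', e'⟩⟩ := mem_iUnion₂.1 hp
      rcases p with ⟨x, y⟩
      obtain rfl : ⟨i, c⟩ = x := e
      obtain rfl : ⟨i', c'⟩ = y := e'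
      exact Or.inr ⟨(coneSum_level ⟨i, c⟩).trans_le (hn i c hc),
        (coneSum_level ⟨i', c'⟩).trans_le (hn i' c' hc')⟩
  proper B hB := by
    obtain ⟨n, hn⟩ := continuouslyControlled.bounded_iff.1 hB
    exact (disjUnion_bounded_level_le K n).mono fun x hx =>
      (coneSum_level x).symm.trans_le (hn _ hx)

/-- An index is needed to lift the apex. This is why the union over the empty index type is treated
separately. -/
theorem coneSum_surjective [Nonempty ι]
    (hj : IsHomeomorph (fun p : Σ i, K i => (j p.1).hom.hom p.2)) :
    Function.Surjective (coneSum j) := by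
  rintro ⟨c, hc⟩
  rcases Cone.eq_apex_or_mk c with rfl | ⟨y, t, -, rfl⟩
  · exact ⟨⟨Classical.arbitrary ι, Cone.apex _, zero_lt_one⟩, rfl⟩
  · obtain ⟨⟨i, x⟩, rfl⟩ := hj.surjective y
    exact ⟨⟨i, Cone.mk x t, hc⟩, rfl⟩

theorem coneSum_injective_of_height_ne
    (hj : IsHomeomorph (fun p : Σ i, K i => (j p.1).hom.hom p.2))
    {x x' : Σ i, OpenCone (K i)}
    (h : coneSum j x = coneSum j x') (hx : x.2.1.height ≠ 0) : x = x' := by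
  have hh : x.2.1.height = x'.2.1.height := by
    rw [← coneSum_height (j := j), ← coneSum_height (j := j), h]
  rcases x with ⟨i, c, hc⟩
  rcases x' with ⟨i', c', hc'⟩
  obtain ⟨z, hz⟩ := Cone.exists_eq_mk_of_height_ne hx
  obtain ⟨z', hz'⟩ := Cone.exists_eq_mk_of_height_ne (hh ▸ hx)
  dsimp only at hh hz hz' hx
  have e : Cone.mk ((j i).hom.hom z) c.height = Cone.mk ((j i').hom.hom z') c'.height := by
    have := congrArg Subtype.val h
    change Cone.map (j i).hom.hom c = Cone.map (j i').hom.hom c' at this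
    rw [hz, hz'] at this
    exact this
  have e2 : (⟨i, z⟩ : Σ i, K i) = ⟨i', z'⟩ :=
    hj.injective (Cone.mk_injective e (unitInterval.pos_iff_ne_zero.2 hx))
  obtain ⟨rfl, e3⟩ := Sigma.mk.inj_iff.1 e2
  obtain rfl := eq_of_heq e3
  have : c = c' := by rw [hz, hz', hh]
  subst this
  rfl

-- Injectivity of `j i` carries over to closed cones at height `1`, so limits at infinity that
-- coincide in the cone of `L` already coincide in the cone of `K i`.
open Filter in
theorem controlled_preimage_openConeMap
    (hj : IsHomeomorph (fun p : Σ i, K i => (j p.1).hom.hom p.2))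
    {M : Set (OpenCone L × OpenCone L)}
    (hM : (continuouslyControlled L).Controlled M) (i : ι) :
    (continuouslyControlled (K i)).Controlled
      {p | (coneSum j ⟨i, p.1⟩, coneSum j ⟨i, p.2⟩) ∈ M} := by
  have hinj : Function.Injective (j i).hom.hom := fun x y hxy =>
    sigma_mk_injective (β := fun i => K i) (hj.injective (a₁ := ⟨i, x⟩) (a₂ := ⟨i, y⟩) hxy)
  have key := continuouslyControlled.controlled_image (X := K i)
    (S := {p : OpenCone (K i) × OpenCone (K i) | (coneSum j ⟨i, p.1⟩, coneSum j ⟨i, p.2⟩) ∈ M})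
    (c := Prod.fst) (d := Prod.snd) (by
      intro F hS a b ha hb hab
      have ha' : Tendsto (fun p : OpenCone (K i) × OpenCone (K i) => (coneSum j ⟨i, p.1⟩).1) F
          (𝓝 (Cone.map (j i).hom.hom a)) := ((Cone.continuous_map _).tendsto a).comp ha
      have hb' : Tendsto (fun p : OpenCone (K i) × OpenCone (K i) => (coneSum j ⟨i, p.2⟩).1) F
          (𝓝 (Cone.map (j i).hom.hom b)) := ((Cone.continuous_map _).tendsto b).comp hb
      have e : Cone.map (j i).hom.hom a = Cone.map (j i).hom.hom b :=
        continuouslyControlled.eq_of_tendsto hM hS ha' hb' (by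
          rwa [Cone.height_map, Cone.height_map])
      have hh : a.height = b.height := by
        rw [← Cone.height_map (j i).hom.hom a, e, Cone.height_map]
      have ha0 : a.height ≠ 0 := by
        rw [← hh, or_self] at hab
        rw [hab]
        exact one_ne_zero
      obtain ⟨x, hx⟩ := Cone.exists_eq_mk_of_height_ne ha0
      obtain ⟨y, hy⟩ := Cone.exists_eq_mk_of_height_ne (hh ▸ ha0)
      rw [hx, hy, Cone.map_mk, Cone.map_mk] at e
      rw [hx, hy, hinj (Cone.mk_injective e (unitInterval.pos_iff_ne_zero.2 ha0)), hh])
  simpa using key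

/-- Away from the apex, two points with different indices lie over the clopen image of one summand
and over its complement, which are disjoint closed sets. -/
theorem exists_level_le_of_index_ne
    (hj : IsHomeomorph (fun p : Σ i, K i => (j p.1).hom.hom p.2))
    {s : OpenCone L → Σ i, OpenCone (K i)}
    (hs : ∀ c, coneSum j (s c) = c) {M : Set (OpenCone L × OpenCone L)}
    (hM : (continuouslyControlled L).Controlled M) :
    ∃ n, ∀ p ∈ M, (s p.1).1 ≠ (s p.2).1 → level p.2 ≤ n := by
  have hfin := finite_setOf_nonempty hj
  have hbase : ∀ c : OpenCone L, c.1.height ≠ 0 →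
      ∃ y ∈ range (j (s c).1).hom.hom, c.1 = Cone.mk y c.1.height := by
    intro c hc
    have hc' : (s c).2.1.height ≠ 0 := by rwa [← coneSum_height (j := j), hs]
    obtain ⟨x, hx⟩ := Cone.exists_eq_mk_of_height_ne hc'
    refine ⟨_, ⟨x, rfl⟩, ?_⟩
    have h1 : c.1 = Cone.map (j (s c).1).hom.hom (s c).2.1 := congrArg Subtype.val (hs c).symm
    rw [h1, Cone.height_map]
    exact congrArg (Cone.map _) hx
  have hopen : ∀ i, IsOpen (range (j i).hom.hom) := fun i =>
    (hj.isOpenMap.comp (isOpenMap_sigmaMk (i := i))).isOpen_range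
  choose n hn using fun i => continuouslyControlled.exists_level_le_of_disjoint hM
    (isCompact_range (j i).hom.hom.continuous).isClosed (hopen i).isClosed_compl
    disjoint_compl_right
  obtain ⟨m, hm⟩ := continuouslyControlled.exists_level_le hM 0
  -- The supremum treats pairs of points off the apex; `m` treats those whose first point is the
  -- apex, where `s` picks an arbitrary index.
  refine ⟨max (hfin.toFinset.sup n) m, fun p hp hne => ?_⟩
  by_cases h1 : p.1.1.height = 0
  · exact le_max_of_le_right (hm p hp (level_eq_zero h1).le)
  by_cases h2 : p.2.1.height = 0
  · exact (level_eq_zero h2).trans_le bot_le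
  obtain ⟨y₁, ⟨x₁, rfl⟩, hy₁⟩ := hbase _ h1
  obtain ⟨y₂, ⟨x₂, rfl⟩, hy₂⟩ := hbase _ h2
  refine le_max_of_le_left ((hn (s p.1).1 p hp ⟨_, ⟨x₁, rfl⟩, hy₁⟩ ⟨_, ?_, hy₂⟩).trans
    (Finset.le_sup (f := n) (hfin.mem_toFinset.2 ⟨x₁⟩)))
  rintro ⟨x, hx⟩
  have e : (⟨(s p.1).1, x⟩ : Σ i, K i) = ⟨(s p.2).1, x₂⟩ := hj.injective hx
  exact hne (Sigma.mk.inj_iff.1 e).1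

/-- Pairs with equal index are covered by the preimage of `M` in one summand. Those with different
indices have bounded level, and the coarse disjoint union allows bounded sets of different summands
to be related. -/
theorem isCoarseMap_section_coneSum
    (hj : IsHomeomorph (fun p : Σ i, K i => (j p.1).hom.hom p.2))
    {s : OpenCone L → Σ i, OpenCone (K i)}
    (hs : ∀ c, coneSum j (s c) = c) :
    IsCoarseMap (continuouslyControlled L)
      (CoarseStructure.disjUnion fun i => continuouslyControlled (K i)) s where
  controlled M hM := by
    obtain ⟨n, hn⟩ := exists_level_le_of_index_ne hj hs hM
    obtain ⟨n', hn'⟩ := exists_level_le_of_index_ne hj hs ((continuouslyControlled L).symm hM)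
    have hlevel : ∀ c, level (s c).2 = level c := fun c => by
      rw [← coneSum_level (j := j), hs]
    refine ⟨fun i => {p | (coneSum j ⟨i, p.1⟩, coneSum j ⟨i, p.2⟩) ∈ M},
      fun i => {c | level c ≤ max n n'}, controlled_preimage_openConeMap hj hM,
      fun i => continuouslyControlled.bounded_level_le _, ?_⟩
    rintro _ ⟨⟨a, b⟩, hab, rfl⟩
    by_cases h : (s a).1 = (s b).1
    · left
      have hab' : (coneSum j (s a), coneSum j (s b)) ∈ M := by rwa [hs, hs]
      change (s a, s b) ∈ _
      generalize s a = x at h hab'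
      generalize s b = y at h hab'
      rcases x with ⟨i, c⟩
      rcases y with ⟨i', c'⟩
      obtain rfl : i = i' := h
      exact mem_iUnion.2 ⟨i, (c, c'), hab', rfl⟩
    · refine Or.inr (mem_iUnion₂.2 ⟨(s a).1, (s b).1, ⟨(s a).2, ?_, rfl⟩, ⟨(s b).2, ?_, rfl⟩⟩)
      · exact (hlevel a).trans_le (le_max_of_le_right (hn' (b, a) hab (Ne.symm h)))
      · exact (hlevel b).trans_le (le_max_of_le_left (hn (a, b) hab h))
  proper B hB := by
    refine ((isCoarseMap_coneSum (finite_setOf_nonempty hj) j).bounded_image hB).mono fun c hc => ?_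
    exact ⟨s c, hc, hs c⟩

/-- The map `⋁ 𝒪(K i) → 𝒪L` for a disjoint union `L = ∐ K i`, as a coarse map. -/
def coneSumHom (hj : IsHomeomorph (fun p : Σ i, K i => (j p.1).hom.hom p.2)) :
    CoarseSpace.disjUnion (fun i => openCone (K i)) ⟶ openCone L :=
  ⟨coneSum j, isCoarseMap_coneSum (finite_setOf_nonempty hj) j⟩

/-- A section `s` is a strict right inverse. In the other order the composite is the identity except
that apexes may be permuted among summands, which is a bounded change; so it is close to the
identity. -/
theorem isCoarseHomotopyEquiv_coneSumHom [Nonempty ι]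
    (hj : IsHomeomorph (fun p : Σ i, K i => (j p.1).hom.hom p.2)) :
    CoarseSpace.IsCoarseHomotopyEquiv (coneSumHom hj) := by
  obtain ⟨s, hs⟩ := (coneSum_surjective hj).hasRightInverse
  refine ⟨⟨s, isCoarseMap_section_coneSum hj hs⟩, .rel _ _ ?_, ?_⟩
  · have hlevel : IsCoarseMap (CoarseSpace.disjUnion (fun i => openCone (K i))).str properRay
        fun x => level (coneSum j x) := by
      have h1 := isCoarseMap_coneSum (finite_setOf_nonempty hj) j
      have h2 := continuouslyControlled.isCoarseMap_level (X := L)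
      refine ⟨fun M hM => ?_, fun B hB => h1.proper _ (h2.proper B hB)⟩
      refine properRay.subset (h2.controlled _ (h1.controlled M hM)) ?_
      rintro _ ⟨p, hp, rfl⟩
      exact ⟨_, ⟨p, hp, rfl⟩, rfl⟩
    refine CoarseSpace.elementaryHomotopic_of_close ?_ hlevel
    have hb := disjUnion_bounded_level_le K 0
    refine CoarseStructure.subset _ (CoarseStructure.union _ (CoarseStructure.diag _)
      (hb.prod hb)) ?_
    rintro _ ⟨x, rfl⟩
    by_cases hx : x.2.1.height = 0
    · have h0 : level (s (coneSum j x)).2 = 0 := by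
        rw [← coneSum_level (j := j), hs]
        exact (coneSum_level x).trans (level_eq_zero hx)
      exact Or.inr ⟨h0.le, (level_eq_zero hx).le⟩
    · exact Or.inl (coneSum_injective_of_height_ne hj (hs (coneSum j x)).symm hx).symm
  · have : (⟨s, isCoarseMap_section_coneSum hj hs⟩ :
        openCone L ⟶ CoarseSpace.disjUnion fun i => openCone (K i)) ≫
        coneSumHom hj = 𝟙 (openCone L) := CoarseSpace.Hom.ext (funext hs)
    rw [this]
    exact .refl _

theorem IsCoarselyExcisive.isWeakEquiv_wedgeDesc_of_nonempty [Nonempty ι]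
    (hj : IsHomeomorph (fun p : Σ i, K i => (j p.1).hom.hom p.2))
    {E : CoarseSpace.{u} ⥤ TopSpectrum.{v}} (hE : IsCoarselyExcisive E) :
    Hom.IsWeakEquiv (wedgeDesc fun i => E.map (openConeMap (j i))) := by
  intro k
  rw [Hom.mapPi_comp_of_app (wedgeDesc fun i => E.map (CoarseSpace.disjIncl
    (fun i => openCone (K i)) i)) (E.map (coneSumHom hj)) (wedgeDesc fun i =>
      E.map (openConeMap (j i))) ?_ k]
  · exact (hE.homotopy _ _ _ (isCoarseHomotopyEquiv_coneSumHom hj) k).comp (hE.disjoint _ _ k)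
  · intro n x
    induction x using Quot.ind with | mk a => ?_
    rcases a with _ | ⟨i, x⟩
    · exact (Hom.app_pt (E.map (coneSumHom hj)) n).symm
    · have e : openConeMap (j i) =
          CoarseSpace.disjIncl (fun i => openCone (K i)) i ≫ coneSumHom hj := rfl
      change (E.map (openConeMap (j i))).app n x = _
      rw [e, E.map_comp]
      rfl

end DisjointUnion

namespace IsCoarselyExcisive

variable {E : CoarseSpace.{u} ⥤ TopSpectrum.{v}}

/-- The empty space is the disjoint union of two copies of itself, so the fold map of `E(𝒪∅) ∨
E(𝒪∅)` is a weak equivalence. It identifies the two summand inclusions, which therefore agree on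
`π_k`. The map out of the wedge that is trivial on one summand and the identity on the other then
shows that the identity is trivial on `π_k`. -/
theorem weaklyContractible_of_isEmpty (hE : IsCoarselyExcisive E) (Y : CompHaus.{u})
    [IsEmpty Y] : (E.obj (openCone Y)).WeaklyContractible := by
  let j : ULift.{u} Bool → (Y ⟶ Y) := fun _ => 𝟙 Y
  have hj : IsHomeomorph (fun p : Σ _ : ULift.{u} Bool, Y => (j p.1).hom.hom p.2) := by
    refine ⟨continuous_of_const fun x => isEmptyElim x.2, fun U _ => ?_, ⟨fun x => isEmptyElim x.2,
      fun y => isEmptyElim y⟩⟩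
    rw [eq_empty_of_isEmpty (_ '' U)]
    exact isOpen_empty
  let A : ULift.{u} Bool → TopSpectrum.{v} := fun _ => E.obj (openCone Y)
  refine weaklyContractible_of_mapPi_zeroHom fun k => ?_
  let D : Hom (wedge A) (E.obj (openCone Y)) := wedgeDesc fun i => E.map (openConeMap (j i))
  have hD : Function.Injective (D.mapPi k) :=
    (hE.isWeakEquiv_wedgeDesc_of_nonempty hj k).injective
  have hin : (wedgeIncl A ⟨true⟩).mapPi k = (wedgeIncl A ⟨false⟩).mapPi k := by
    refine hD.comp_left ?_
    have h := mapPi_wedgeDesc_wedgeIncl (A := A) (fun i => E.map (openConeMap (j i)))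
    exact (h ⟨true⟩ k).symm.trans (h ⟨false⟩ k)
  let g : ∀ i, Hom (A i) (E.obj (openCone Y)) := fun i =>
    bif i.down then zeroHom _ _ else 𝟙 (E.obj (openCone Y))
  have h1 := mapPi_wedgeDesc_wedgeIncl g ⟨true⟩ k
  have h2 := mapPi_wedgeDesc_wedgeIncl g ⟨false⟩ k
  rw [hin, ← h2] at h1
  exact h1.trans (mapPi_id _ k)

theorem isWeakEquiv_wedgeDesc (hE : IsCoarselyExcisive E) {ι : Type u} {K : ι → CompHaus.{u}}
    {L : CompHaus.{u}} {j : ∀ i, K i ⟶ L}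
    (hj : IsHomeomorph (fun p : Σ i, K i => (j p.1).hom.hom p.2)) :
    Hom.IsWeakEquiv (wedgeDesc fun i => E.map (openConeMap (j i))) := by
  rcases isEmpty_or_nonempty ι with hι | hι
  · intro k
    -- Without indices the wedge is levelwise a point and `L` is empty, so both sides have
    -- one-element `π_k`.
    have : IsEmpty L := ⟨fun y => by
      obtain ⟨⟨i, -⟩, -⟩ := hj.surjective y
      exact hι.elim i⟩
    have h1 : Subsingleton (StablePi (wedge fun i => E.obj (openCone (K i))) k) :=
      weaklyContractible_of_subsingleton (fun n => ⟨fun a b => by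
        induction a using Quot.ind with | mk a => ?_
        induction b using Quot.ind with | mk b => ?_
        rcases a with a | ⟨i, -⟩
        · rcases b with b | ⟨i, -⟩
          · rfl
          · exact (hι.false i).elim
        · exact (hι.false i).elim⟩) k
    have h2 := hE.weaklyContractible_of_isEmpty L k
    obtain ⟨a⟩ := nonempty_stablePi (wedge fun i => E.obj (openCone (K i))) k
    exact ⟨fun _ _ _ => h1.elim _ _, fun _ => ⟨a, h2.elim _ _⟩⟩
  · exact hE.isWeakEquiv_wedgeDesc_of_nonempty hj

end IsCoarselyExcisive

theorem mainTheorem5 (E : CoarseSpace.{u} ⥤ TopSpectrum.{v}) (hE : IsCoarselyExcisive E) :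
    (∀ (X Y : hasCWType.{u}.FullSubcategory) (f : X ⟶ Y)
        (e : ContinuousMap.HomotopyEquiv X.obj Y.obj), e.toFun = f.hom.hom.hom →
        TopSpectrum.Hom.IsWeakEquiv ((coneTheory E).map f)) ∧
    (∀ (X : hasCWType.{u}.FullSubcategory) (U V : Set X.obj), IsOpen U → IsOpen V →
        U ∪ V = Set.univ →
        TopSpectrum.IsHomotopyPushout
          (E.map ((openCone X.obj).inclOfLE
            (openConeOver_mono X.obj (Set.inter_subset_left : U ∩ V ⊆ U))))
          (E.map ((openCone X.obj).inclOfLE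
            (openConeOver_mono X.obj (Set.inter_subset_right : U ∩ V ⊆ V))))
          (E.map ((openCone X.obj).subIncl (openConeOver X.obj U)))
          (E.map ((openCone X.obj).subIncl (openConeOver X.obj V)))) ∧
    (∀ (ι : Type u) (X : ι → hasCWType.{u}.FullSubcategory) (Y : hasCWType.{u}.FullSubcategory)
        (j : ∀ i, X i ⟶ Y),
        IsHomeomorph (fun p : Σ i, (X i).obj => (j p.1).hom.hom.hom p.2) →
        TopSpectrum.Hom.IsWeakEquiv
          (TopSpectrum.wedgeDesc fun i => (coneTheory E).map (j i))) := by
  refine ⟨fun X Y f e he => ?_, fun X U V hU hV hUV => ?_, fun ι X Y j hj => ?_⟩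
  · let g : Y.obj ⟶ X.obj := CompHausLike.ofHom _ e.invFun
    refine hE.isWeakEquiv_openConeMap f.hom g ?_ ?_
    · have := e.left_inv
      rw [he] at this
      exact this
    · have := e.right_inv
      rw [he] at this
      exact this
  · exact hE.isHomotopyPushout_openConeOver X.obj hU hV hUV (openConeOver_inter X.obj) _ _
  · exact hE.isWeakEquiv_wedgeDesc (j := fun i => (j i).hom) hj
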